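/- **Theorem (derivability of W6–W10).** Let $\mathscr C$ be a bicategory. Composition is written by juxtaposition (for (pseudo)functors and whiskering) or $\cdot$ (for 1-cells, applied right to left); associativity and unit constraints of $\mathscr C$ and the constraint isomorphisms of pseudofunctors are left implicit, "$\cong$" denotes a pseudonaturality isomorphism of the transformation indicated (or its inverse), and equations of 2-cells are required at every object of $\mathscr C$. A *pseudomonad* $(T,u,m)$ on $\mathscr C$ is a pseudofunctor $T:\mathscr C\to\mathscr C$ with pseudonatural transformations $u:1\to T$, $m:T^2\to T$ and invertible modifications $\alpha: m\cdot uT\Rightarrow \mathrm{id}_T$, $\beta:\mathrm{id}_T\Rightarrow m\cdot Tu$, $\gamma: m\cdot Tm\Rightarrow m\cdot mT$ such that - $\gamma$ whiskered by $TuT$, as a 2-cell $m\cdot Tm\cdot TuT\Rightarrow m\cdot mT\cdot TuT$, equals $m\cdot Tm\cdot TuT\xrightarrow{T\alpha} m\xrightarrow{\beta T} m\cdot mT\cdot TuT$; - $m\cdot Tm\cdot T^2m\xrightarrow{T\gamma}m\cdot Tm\cdot TmT\xrightarrow{\gamma}m\cdot mT\cdot TmT\xrightarrow{\gamma T}m\cdot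 mT\cdot mT^2$ equals $m\cdot Tm\cdot T^2m\xrightarrow{\gamma}m\cdot mT\cdot T^2m\cong m\cdot Tm\cdot mT^2\xrightarrow{\gamma}m\cdot mT\cdot mT^2$. Let $(T,u,m)$ and $(P,\eta,\mu)$ be pseudomonads on $\mathscr C$, with modifications $\alpha,\beta,\gamma$ and $\alpha^P,\beta^P,\gamma^P$ respectively. Let $\lambda:TP\to PT$ be a pseudonatural transformation and let $$\omega_1:Pu\Rightarrow\lambda\cdot uP,\quad \omega_2:\lambda\cdot T\eta\Rightarrow\eta T,\quad \omega_3:Pm\cdot\lambda T\cdot T\lambda\Rightarrow\lambda\cdot mP,\quad \omega_4:\lambda\cdot T\mu\Rightarrow\mu T\cdot P\lambda\cdot\lambda P$$ be invertible modifications. Suppose that $(\lambda,\omega_1,\omega_2,\omega_3,\omega_4)$ is a pseudodistributive law, i.e. that the following five axioms hold. - **(W1)** $\lambda\xrightarrow{P\beta}Pm\cdot PTu\cdot\lambda\cong Pm\cdot\lambda T\cdot TPu\xrightarrow{T\omega_1}Pm\cdot\lambda T\cdot T\lambda\cdot TuP\xrightarrow{\omega_3}\lambda\cdot mP\cdot TuP\xrightarrow{\beta^{-1}P}\lambda$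 is $\mathrm{id}_\lambda$. - **(W2)** $\lambda\xrightarrow{T(\alpha^P)^{-1}}\lambda\cdot T\mu\cdot T\eta P\xrightarrow{\omega_4}\mu T\cdot P\lambda\cdot\lambda P\cdot T\eta P\xrightarrow{\omega_2P}\mu T\cdot P\lambda\cdot\eta TP\cong\mu T\cdot\eta PT\cdot\lambda\xrightarrow{\alpha^PT}\lambda$ is $\mathrm{id}_\lambda$. - **(W3)** The composites $Pm\cdot PTm\cdot\lambda T^2\cdot T\lambda T\cdot T^2\lambda\cong Pm\cdot\lambda T\cdot TPm\cdot T\lambda T\cdot T^2\lambda\xrightarrow{T\omega_3}Pm\cdot\lambda T\cdot T\lambda\cdot TmP\xrightarrow{\omega_3}\lambda\cdot mP\cdot TmP\xrightarrow{\gamma P}\lambda\cdot mP\cdot mTP$ and $Pm\cdot PTm\cdot\lambda T^2\cdot T\lambda T\cdot T^2\lambda\xrightarrow{P\gamma}Pm\cdot PmT\cdot\lambda T^2\cdot T\lambda T\cdot T^2\lambda\xrightarrow{\omega_3T}Pm\cdot\lambda T\cdot mPT\cdot T^2\lambda\cong Pm\cdot\lambda T\cdot T\lambda\cdot mTP\xrightarrow{\omega_3}\lambda\cdot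 mP\cdot mTP$ are equal. - **(W4)** The composites $\lambda\cdot T\mu\cdot TP\mu\xrightarrow{T\gamma^P}\lambda\cdot T\mu\cdot T\mu P\xrightarrow{\omega_4}\mu T\cdot P\lambda\cdot\lambda P\cdot T\mu P\xrightarrow{\omega_4P}\mu T\cdot P\lambda\cdot\mu TP\cdot P\lambda P\cdot\lambda P^2\cong\mu T\cdot\mu PT\cdot P^2\lambda\cdot P\lambda P\cdot\lambda P^2$ and $\lambda\cdot T\mu\cdot TP\mu\xrightarrow{\omega_4}\mu T\cdot P\lambda\cdot\lambda P\cdot TP\mu\cong\mu T\cdot P\lambda\cdot PT\mu\cdot\lambda P^2\xrightarrow{P\omega_4}\mu T\cdot P\mu T\cdot P^2\lambda\cdot P\lambda P\cdot\lambda P^2\xrightarrow{\gamma^PT}\mu T\cdot\mu PT\cdot P^2\lambda\cdot P\lambda P\cdot\lambda P^2$ are equal. - **(W5)** The composites $Pm\cdot\lambda T\cdot T\lambda\cdot T^2\mu\xrightarrow{T\omega_4}Pm\cdot\lambda T\cdot T\mu T\cdot TP\lambda\cdot T\lambda P\xrightarrow{\omega_4T}Pm\cdot\mu T^2\cdot P\lambda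 T\cdot\lambda PT\cdot TP\lambda\cdot T\lambda P\cong\mu T\cdot P^2m\cdot P\lambda T\cdot PT\lambda\cdot\lambda TP\cdot T\lambda P\xrightarrow{P\omega_3}\mu T\cdot P\lambda\cdot PmP\cdot\lambda TP\cdot T\lambda P\xrightarrow{\omega_3P}\mu T\cdot P\lambda\cdot\lambda P\cdot mP^2$ and $Pm\cdot\lambda T\cdot T\lambda\cdot T^2\mu\xrightarrow{\omega_3}\lambda\cdot mP\cdot T^2\mu\cong\lambda\cdot T\mu\cdot mP^2\xrightarrow{\omega_4}\mu T\cdot P\lambda\cdot\lambda P\cdot mP^2$ are equal. Then the following five conditions also hold. - **(W6)** $\lambda\xrightarrow{P\alpha^{-1}}Pm\cdot PuT\cdot\lambda\xrightarrow{\omega_1T}Pm\cdot\lambda T\cdot uPT\cdot\lambda\cong Pm\cdot\lambda T\cdot T\lambda\cdot uTP\xrightarrow{\omega_3}\lambda\cdot mP\cdot uTP\xrightarrow{\alpha P}\lambda$ is $\mathrm{id}_\lambda$. - **(W7)** $\lambda\xrightarrow{T\beta^P}\lambda\cdot T\mu\cdot TP\eta\xrightarrow{\omega_4}\mu T\cdot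 P\lambda\cdot\lambda P\cdot TP\eta\cong\mu T\cdot P\lambda\cdot PT\eta\cdot\lambda\xrightarrow{P\omega_2}\mu T\cdot P\eta T\cdot\lambda\xrightarrow{(\beta^P)^{-1}T}\lambda$ is $\mathrm{id}_\lambda$. - **(W8)** $Pm\cdot\lambda T\cdot T\lambda\cdot T^2\eta\xrightarrow{\omega_3}\lambda\cdot mP\cdot T^2\eta\cong\lambda\cdot T\eta\cdot m\xrightarrow{\omega_2}\eta T\cdot m$ equals $Pm\cdot\lambda T\cdot T\lambda\cdot T^2\eta\xrightarrow{T\omega_2}Pm\cdot\lambda T\cdot T\eta T\xrightarrow{\omega_2T}Pm\cdot\eta T^2\cong\eta T\cdot m$. - **(W9)** $Pu\cdot\mu\xrightarrow{\omega_1}\lambda\cdot uP\cdot\mu\cong\lambda\cdot T\mu\cdot uP^2\xrightarrow{\omega_4}\mu T\cdot P\lambda\cdot\lambda P\cdot uP^2$ equals $Pu\cdot\mu\cong\mu T\cdot P^2u\xrightarrow{P\omega_1}\mu T\cdot P\lambda\cdot PuP\xrightarrow{\omega_1P}\mu T\cdot P\lambda\cdot\lambda P\cdot uP^2$. - **(W10)**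 $Pu\cdot\eta\xrightarrow{\omega_1}\lambda\cdot uP\cdot\eta\cong\lambda\cdot T\eta\cdot u\xrightarrow{\omega_2}\eta T\cdot u$ equals the pseudonaturality isomorphism $Pu\cdot\eta\cong\eta T\cdot u$ of $\eta$. -/

import Mathlib

open CategoryTheory Bicategory

universe w v u

/-! Throughout, composition of 1-cells is written in diagrammatic order: `f ≫ g` is `g ∘ f`.
The composite pseudofunctor `T ∘ P`, written `TP`, is `P.comp T`.  The operation `⊗≫` composes
2-cells of a bicategory, inserting the unique structural isomorphism (built from associators and
unitors) that is needed in between. -/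

section Squares

variable {C : Type u} [Bicategory.{w, v} C]

/-- `F (h ∘ g ∘ f) ≅ F h ∘ F g ∘ F f` for a pseudofunctor `F`. -/
def CategoryTheory.Pseudofunctor.mapCompThree (F : C ⥤ᵖ C) {a b c d : C}
    (f : a ⟶ b) (g : b ⟶ c) (h : c ⟶ d) :
    F.map (f ≫ g ≫ h) ≅ F.map f ≫ F.map g ≫ F.map h :=
  F.mapComp f (g ≫ h) ≪≫ whiskerLeftIso (F.map f) (F.mapComp g h)

/-- The image of a 2-cell `θ` under a pseudofunctor, with source and target rewritten along
(constraint) isomorphisms `e` and `e'`. -/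
def CategoryTheory.Pseudofunctor.mapCell (F : C ⥤ᵖ C) {a b : C} {f f' : a ⟶ b}
    {p p' : F.obj a ⟶ F.obj b} (e : F.map f ≅ p) (e' : F.map f' ≅ p') (θ : f ⟶ f') : p ⟶ p' :=
  e.inv ≫ F.map₂ θ ≫ e'.hom

/-- The image of an invertible square under a pseudofunctor. -/
def CategoryTheory.Pseudofunctor.mapSquare (F : C ⥤ᵖ C) {a b c d : C} {f : a ⟶ b} {g : b ⟶ d}
    {g' : a ⟶ c} {f' : c ⟶ d} (s : f ≫ g ≅ g' ≫ f') :
    F.map f ≫ F.map g ≅ F.map g' ≫ F.map f' :=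
  (F.mapComp f g).symm ≪≫ F.map₂Iso s ≪≫ F.mapComp g' f'

/-- The pasting of two invertible squares along a common side `f'`. -/
def pasteSquare {a b c a' b' c' : C} {f : a ⟶ a'} {f' : b ⟶ b'} {f'' : c ⟶ c'}
    {g : a ⟶ b} {g' : a' ⟶ b'} {h : b ⟶ c} {h' : b' ⟶ c'}
    (s : f ≫ g' ≅ g ≫ f') (t : f' ≫ h' ≅ h ≫ f'') : f ≫ (g' ≫ h') ≅ (g ≫ h) ≫ f'' :=
  (α_ f g' h').symm ≪≫ whiskerRightIso s h' ≪≫ α_ g f' h' ≪≫ whiskerLeftIso g t ≪≫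
    (α_ g h f'').symm

/-- The identity square on a 1-cell. -/
def idSquare {a b : C} (f : a ⟶ b) : f ≫ 𝟙 b ≅ 𝟙 a ≫ f := ρ_ f ≪≫ (λ_ f).symm

end Squares

/-- An endo-pseudofunctor `T` with pseudonatural transformations `u : 1 → T`, `m : T² → T`. -/
structure PseudomonadData (C : Type u) [Bicategory.{w, v} C] where
  /-- the underlying pseudofunctor `T` -/
  F : C ⥤ᵖ C
  /-- the unit `1 → T` -/
  unit : Pseudofunctor.StrongTrans (Pseudofunctor.id C) F
  /-- the multiplication `T² → T` -/
  mul : Pseudofunctor.StrongTrans (F.comp F) F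

namespace PseudomonadData

variable {C : Type u} [Bicategory.{w, v} C] (T : PseudomonadData C)

/-- The component `u_X : X ⟶ T X`. -/
def u (X : C) : X ⟶ T.F.obj X := T.unit.app X

/-- The pseudonaturality cell `u_Y ∘ f ≅ T f ∘ u_X`. -/
def uNat {X Y : C} (f : X ⟶ Y) : f ≫ T.u Y ≅ T.u X ≫ T.F.map f := T.unit.naturality f

/-- The component `m_X : T² X ⟶ T X`. -/
def m (X : C) : T.F.obj (T.F.obj X) ⟶ T.F.obj X := T.mul.app X

/-- The pseudonaturality cell `m_Y ∘ T² f ≅ T f ∘ m_X`. -/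
def mNat {X Y : C} (f : X ⟶ Y) : T.F.map (T.F.map f) ≫ T.m Y ≅ T.m X ≫ T.F.map f :=
  T.mul.naturality f

end PseudomonadData

/-- A pseudomonad (in pseudomonoidal form) on a bicategory: a pseudofunctor `T`, pseudonatural
transformations `u : 1 → T`, `m : T² → T`, and invertible modifications
`α : m ∘ uT ⇒ id`, `β : id ⇒ m ∘ Tu`, `γ : m ∘ Tm ⇒ m ∘ mT`, subject to two axioms. -/
structure Pseudomonad (C : Type u) [Bicategory.{w, v} C] extends PseudomonadData C where
  α (X : C) : toPseudomonadData.u (F.obj X) ≫ toPseudomonadData.m X ≅ 𝟙 (F.obj X)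
  α_modification {X Y : C} (f : X ⟶ Y) :
    F.map f ◁ (α Y).hom ≫ (idSquare (F.map f)).hom =
      (pasteSquare (toPseudomonadData.uNat (F.map f)) (toPseudomonadData.mNat f)).hom ≫
        (α X).hom ▷ F.map f
  β (X : C) : 𝟙 (F.obj X) ≅ F.map (toPseudomonadData.u X) ≫ toPseudomonadData.m X
  β_modification {X Y : C} (f : X ⟶ Y) :
    F.map f ◁ (β Y).hom ≫
        (pasteSquare (F.mapSquare (toPseudomonadData.uNat f)) (toPseudomonadData.mNat f)).hom =
      (idSquare (F.map f)).hom ≫ (β X).hom ▷ F.map f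
  γ (X : C) : F.map (toPseudomonadData.m X) ≫ toPseudomonadData.m X ≅
    toPseudomonadData.m (F.obj X) ≫ toPseudomonadData.m X
  γ_modification {X Y : C} (f : X ⟶ Y) :
    F.map (F.map (F.map f)) ◁ (γ Y).hom ≫
        (pasteSquare (toPseudomonadData.mNat (F.map f)) (toPseudomonadData.mNat f)).hom =
      (pasteSquare (F.mapSquare (toPseudomonadData.mNat f)) (toPseudomonadData.mNat f)).hom ≫
        (γ X).hom ▷ F.map f
  /-- the unit axiom, between 2-cells `m ∘ Tm ∘ TuT ⇒ m ∘ mT ∘ TuT` -/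
  unit_axiom (X : C) :
    F.map (toPseudomonadData.u (F.obj X)) ◁ (γ X).hom =
      𝟙 _ ⊗≫ F.mapCell (F.mapComp _ _) (F.mapId _) (α X).hom ▷ toPseudomonadData.m X ⊗≫
        (β (F.obj X)).hom ▷ toPseudomonadData.m X ⊗≫ 𝟙 _
  /-- the associativity axiom, between 2-cells `m ∘ Tm ∘ T²m ⇒ m ∘ mT ∘ mT²` -/
  assoc_axiom (X : C) :
    (𝟙 (F.map (F.map (toPseudomonadData.m X)) ≫ F.map (toPseudomonadData.m X) ≫
          toPseudomonadData.m X) ⊗≫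
        F.mapCell (F.mapComp _ _) (F.mapComp _ _) (γ X).hom ▷ toPseudomonadData.m X ⊗≫
        F.map (toPseudomonadData.m (F.obj X)) ◁ (γ X).hom ⊗≫
        (γ (F.obj X)).hom ▷ toPseudomonadData.m X ⊗≫
        𝟙 (toPseudomonadData.m (F.obj (F.obj X)) ≫ toPseudomonadData.m (F.obj X) ≫
          toPseudomonadData.m X)) =
      𝟙 _ ⊗≫ F.map (F.map (toPseudomonadData.m X)) ◁ (γ X).hom ⊗≫
        (toPseudomonadData.mNat (toPseudomonadData.m X)).hom ▷ toPseudomonadData.m X ⊗≫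
        toPseudomonadData.m (F.obj (F.obj X)) ◁ (γ X).hom ⊗≫ 𝟙 _

section PseudodistributiveLaw

variable {C : Type u} [Bicategory.{w, v} C]

/-- A pseudonatural transformation `λ : TP → PT`. -/
structure DistributorData (T P : Pseudomonad C) where
  /-- the transformation `λ : TP → PT` -/
  trans : Pseudofunctor.StrongTrans (P.F.comp T.F) (T.F.comp P.F)

namespace DistributorData

variable {T P : Pseudomonad C} (D : DistributorData T P)

/-- The component `λ_X : T P X ⟶ P T X`. -/
def lam (X : C) : T.F.obj (P.F.obj X) ⟶ P.F.obj (T.F.obj X) := D.trans.app X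

/-- The pseudonaturality cell `λ_Y ∘ TP f ≅ PT f ∘ λ_X`. -/
def lamNat {X Y : C} (f : X ⟶ Y) :
    T.F.map (P.F.map f) ≫ D.lam Y ≅ D.lam X ≫ P.F.map (T.F.map f) := D.trans.naturality f

end DistributorData

/-- The data of a pseudodistributive law (in pseudomonoidal form) between pseudomonads
`(T, u, m)` and `(P, η, μ)`: a pseudonatural transformation `λ : TP → PT` with invertible
modifications `ω₁ : Pu ⇒ λ ∘ uP`, `ω₂ : λ ∘ Tη ⇒ ηT`, `ω₃ : Pm ∘ λT ∘ Tλ ⇒ λ ∘ mP` and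
`ω₄ : λ ∘ Tμ ⇒ μT ∘ Pλ ∘ λP`. -/
structure PseudodistributiveData (T P : Pseudomonad C) extends DistributorData T P where
  ω₁ (X : C) : P.F.map (T.u X) ≅ T.u (P.F.obj X) ≫ toDistributorData.lam X
  ω₁_modification {X Y : C} (f : X ⟶ Y) :
    P.F.map f ◁ (ω₁ Y).hom ≫
        (pasteSquare (T.uNat (P.F.map f)) (toDistributorData.lamNat f)).hom =
      (P.F.mapSquare (T.uNat f)).hom ≫ (ω₁ X).hom ▷ P.F.map (T.F.map f)
  ω₂ (X : C) : T.F.map (P.u X) ≫ toDistributorData.lam X ≅ P.u (T.F.obj X)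
  ω₂_modification {X Y : C} (f : X ⟶ Y) :
    T.F.map f ◁ (ω₂ Y).hom ≫ (P.uNat (T.F.map f)).hom =
      (pasteSquare (T.F.mapSquare (P.uNat f)) (toDistributorData.lamNat f)).hom ≫
        (ω₂ X).hom ▷ P.F.map (T.F.map f)
  ω₃ (X : C) :
    T.F.map (toDistributorData.lam X) ≫ toDistributorData.lam (T.F.obj X) ≫ P.F.map (T.m X) ≅
      T.m (P.F.obj X) ≫ toDistributorData.lam X
  ω₃_modification {X Y : C} (f : X ⟶ Y) :
    T.F.map (T.F.map (P.F.map f)) ◁ (ω₃ Y).hom ≫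
        (pasteSquare (T.mNat (P.F.map f)) (toDistributorData.lamNat f)).hom =
      (pasteSquare (T.F.mapSquare (toDistributorData.lamNat f))
          (pasteSquare (toDistributorData.lamNat (T.F.map f))
            (P.F.mapSquare (T.mNat f)))).hom ≫
        (ω₃ X).hom ▷ P.F.map (T.F.map f)
  ω₄ (X : C) :
    T.F.map (P.m X) ≫ toDistributorData.lam X ≅
      toDistributorData.lam (P.F.obj X) ≫ P.F.map (toDistributorData.lam X) ≫ P.m (T.F.obj X)
  ω₄_modification {X Y : C} (f : X ⟶ Y) :
    T.F.map (P.F.map (P.F.map f)) ◁ (ω₄ Y).hom ≫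
        (pasteSquare (toDistributorData.lamNat (P.F.map f))
          (pasteSquare (P.F.mapSquare (toDistributorData.lamNat f))
            (P.mNat (T.F.map f)))).hom =
      (pasteSquare (T.F.mapSquare (P.mNat f)) (toDistributorData.lamNat f)).hom ≫
        (ω₄ X).hom ▷ P.F.map (T.F.map f)

namespace PseudodistributiveData

variable {T P : Pseudomonad C} (D : PseudodistributiveData T P)

/-- `λ ⇒ Pm ∘ PTu ∘ λ ⇒ Pm ∘ λT ∘ TPu ⇒ Pm ∘ λT ∘ Tλ ∘ TuP ⇒ λ ∘ mP ∘ TuP ⇒ λ`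
is the identity. -/
def W1 : Prop := ∀ X : C,
  (𝟙 (D.lam X) ⊗≫
    D.lam X ◁ P.F.mapCell (P.F.mapId _) (P.F.mapComp _ _) (T.β X).hom ⊗≫
    (D.lamNat (T.u X)).inv ▷ P.F.map (T.m X) ⊗≫
    T.F.mapCell (Iso.refl _) (T.F.mapComp _ _) (D.ω₁ X).hom ▷
      (D.lam (T.F.obj X) ≫ P.F.map (T.m X)) ⊗≫
    T.F.map (T.u (P.F.obj X)) ◁ (D.ω₃ X).hom ⊗≫
    (T.β (P.F.obj X)).inv ▷ D.lam X ⊗≫ 𝟙 (D.lam X)) = 𝟙 (D.lam X)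

/-- `λ ⇒ λ ∘ Tμ ∘ TηP ⇒ μT ∘ Pλ ∘ λP ∘ TηP ⇒ μT ∘ Pλ ∘ ηTP ⇒ μT ∘ ηPT ∘ λ ⇒ λ`
is the identity. -/
def W2 : Prop := ∀ X : C,
  (𝟙 (D.lam X) ⊗≫
    T.F.mapCell (T.F.mapId _) (T.F.mapComp _ _) (P.α X).inv ▷ D.lam X ⊗≫
    T.F.map (P.u (P.F.obj X)) ◁ (D.ω₄ X).hom ⊗≫
    (D.ω₂ (P.F.obj X)).hom ▷ (P.F.map (D.lam X) ≫ P.m (T.F.obj X)) ⊗≫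
    (P.uNat (D.lam X)).inv ▷ P.m (T.F.obj X) ⊗≫
    D.lam X ◁ (P.α (T.F.obj X)).hom ⊗≫ 𝟙 (D.lam X)) = 𝟙 (D.lam X)

/-- The two composites `Pm ∘ PTm ∘ λT² ∘ TλT ∘ T²λ ⇒ λ ∘ mP ∘ mTP` agree. -/
def W3 : Prop := ∀ X : C,
  (𝟙 (T.F.map (T.F.map (D.lam X)) ≫ T.F.map (D.lam (T.F.obj X)) ≫ D.lam (T.F.obj (T.F.obj X)) ≫
        P.F.map (T.F.map (T.m X)) ≫ P.F.map (T.m X)) ⊗≫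
    (T.F.map (T.F.map (D.lam X)) ≫ T.F.map (D.lam (T.F.obj X))) ◁
      (D.lamNat (T.m X)).inv ▷ P.F.map (T.m X) ⊗≫
    T.F.mapCell (T.F.mapCompThree _ _ _) (T.F.mapComp _ _) (D.ω₃ X).hom ▷
      (D.lam (T.F.obj X) ≫ P.F.map (T.m X)) ⊗≫
    T.F.map (T.m (P.F.obj X)) ◁ (D.ω₃ X).hom ⊗≫
    (T.γ (P.F.obj X)).hom ▷ D.lam X ⊗≫
    𝟙 (T.m (T.F.obj (P.F.obj X)) ≫ T.m (P.F.obj X) ≫ D.lam X)) =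
  𝟙 _ ⊗≫
    (T.F.map (T.F.map (D.lam X)) ≫ T.F.map (D.lam (T.F.obj X)) ≫
      D.lam (T.F.obj (T.F.obj X))) ◁
        P.F.mapCell (P.F.mapComp _ _) (P.F.mapComp _ _) (T.γ X).hom ⊗≫
    T.F.map (T.F.map (D.lam X)) ◁ (D.ω₃ (T.F.obj X)).hom ▷ P.F.map (T.m X) ⊗≫
    (T.mNat (D.lam X)).hom ▷ (D.lam (T.F.obj X) ≫ P.F.map (T.m X)) ⊗≫
    T.m (T.F.obj (P.F.obj X)) ◁ (D.ω₃ X).hom ⊗≫ 𝟙 _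

/-- The two composites `λ ∘ Tμ ∘ TPμ ⇒ μT ∘ μPT ∘ P²λ ∘ PλP ∘ λP²` agree. -/
def W4 : Prop := ∀ X : C,
  (𝟙 (T.F.map (P.F.map (P.m X)) ≫ T.F.map (P.m X) ≫ D.lam X) ⊗≫
    T.F.mapCell (T.F.mapComp _ _) (T.F.mapComp _ _) (P.γ X).hom ▷ D.lam X ⊗≫
    T.F.map (P.m (P.F.obj X)) ◁ (D.ω₄ X).hom ⊗≫
    (D.ω₄ (P.F.obj X)).hom ▷ (P.F.map (D.lam X) ≫ P.m (T.F.obj X)) ⊗≫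
    (D.lam (P.F.obj (P.F.obj X)) ≫ P.F.map (D.lam (P.F.obj X))) ◁
      (P.mNat (D.lam X)).inv ▷ P.m (T.F.obj X) ⊗≫
    𝟙 (D.lam (P.F.obj (P.F.obj X)) ≫ P.F.map (D.lam (P.F.obj X)) ≫
        P.F.map (P.F.map (D.lam X)) ≫ P.m (P.F.obj (T.F.obj X)) ≫ P.m (T.F.obj X))) =
  𝟙 _ ⊗≫
    T.F.map (P.F.map (P.m X)) ◁ (D.ω₄ X).hom ⊗≫
    (D.lamNat (P.m X)).hom ▷ (P.F.map (D.lam X) ≫ P.m (T.F.obj X)) ⊗≫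
    D.lam (P.F.obj (P.F.obj X)) ◁
      P.F.mapCell (P.F.mapComp _ _) (P.F.mapCompThree _ _ _) (D.ω₄ X).hom ▷
        P.m (T.F.obj X) ⊗≫
    (D.lam (P.F.obj (P.F.obj X)) ≫ P.F.map (D.lam (P.F.obj X)) ≫
      P.F.map (P.F.map (D.lam X))) ◁ (P.γ (T.F.obj X)).hom ⊗≫ 𝟙 _

/-- The two composites `Pm ∘ λT ∘ Tλ ∘ T²μ ⇒ μT ∘ Pλ ∘ λP ∘ mP²` agree. -/
def W5 : Prop := ∀ X : C,
  (𝟙 (T.F.map (T.F.map (P.m X)) ≫ T.F.map (D.lam X) ≫ D.lam (T.F.obj X) ≫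
        P.F.map (T.m X)) ⊗≫
    T.F.mapCell (T.F.mapComp _ _) (T.F.mapCompThree _ _ _) (D.ω₄ X).hom ▷
      (D.lam (T.F.obj X) ≫ P.F.map (T.m X)) ⊗≫
    (T.F.map (D.lam (P.F.obj X)) ≫ T.F.map (P.F.map (D.lam X))) ◁
      (D.ω₄ (T.F.obj X)).hom ▷ P.F.map (T.m X) ⊗≫
    T.F.map (D.lam (P.F.obj X)) ◁ (D.lamNat (D.lam X)).hom ▷
      (P.F.map (D.lam (T.F.obj X)) ≫ P.m (T.F.obj (T.F.obj X)) ≫ P.F.map (T.m X)) ⊗≫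
    (T.F.map (D.lam (P.F.obj X)) ≫ D.lam (T.F.obj (P.F.obj X)) ≫
      P.F.map (T.F.map (D.lam X)) ≫ P.F.map (D.lam (T.F.obj X))) ◁ (P.mNat (T.m X)).inv ⊗≫
    (T.F.map (D.lam (P.F.obj X)) ≫ D.lam (T.F.obj (P.F.obj X))) ◁
      P.F.mapCell (P.F.mapCompThree _ _ _) (P.F.mapComp _ _) (D.ω₃ X).hom ▷
        P.m (T.F.obj X) ⊗≫
    (D.ω₃ (P.F.obj X)).hom ▷ (P.F.map (D.lam X) ≫ P.m (T.F.obj X)) ⊗≫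
    𝟙 (T.m (P.F.obj (P.F.obj X)) ≫ D.lam (P.F.obj X) ≫ P.F.map (D.lam X) ≫
        P.m (T.F.obj X))) =
  𝟙 _ ⊗≫
    T.F.map (T.F.map (P.m X)) ◁ (D.ω₃ X).hom ⊗≫
    (T.mNat (P.m X)).hom ▷ D.lam X ⊗≫
    T.m (P.F.obj (P.F.obj X)) ◁ (D.ω₄ X).hom ⊗≫ 𝟙 _

/-- `λ ⇒ Pm ∘ PuT ∘ λ ⇒ Pm ∘ λT ∘ uPT ∘ λ ⇒ Pm ∘ λT ∘ Tλ ∘ uTP ⇒ λ ∘ mP ∘ uTP ⇒ λ`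
is the identity. -/
def W6 : Prop := ∀ X : C,
  (𝟙 (D.lam X) ⊗≫
    D.lam X ◁ P.F.mapCell (P.F.mapId _) (P.F.mapComp _ _) (T.α X).inv ⊗≫
    D.lam X ◁ (D.ω₁ (T.F.obj X)).hom ▷ P.F.map (T.m X) ⊗≫
    (T.uNat (D.lam X)).hom ▷ (D.lam (T.F.obj X) ≫ P.F.map (T.m X)) ⊗≫
    T.u (T.F.obj (P.F.obj X)) ◁ (D.ω₃ X).hom ⊗≫
    (T.α (P.F.obj X)).hom ▷ D.lam X ⊗≫ 𝟙 (D.lam X)) = 𝟙 (D.lam X)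

/-- `λ ⇒ λ ∘ Tμ ∘ TPη ⇒ μT ∘ Pλ ∘ λP ∘ TPη ⇒ μT ∘ Pλ ∘ PTη ∘ λ ⇒ μT ∘ PηT ∘ λ ⇒ λ`
is the identity. -/
def W7 : Prop := ∀ X : C,
  (𝟙 (D.lam X) ⊗≫
    T.F.mapCell (T.F.mapId _) (T.F.mapComp _ _) (P.β X).hom ▷ D.lam X ⊗≫
    T.F.map (P.F.map (P.u X)) ◁ (D.ω₄ X).hom ⊗≫
    (D.lamNat (P.u X)).hom ▷ (P.F.map (D.lam X) ≫ P.m (T.F.obj X)) ⊗≫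
    D.lam X ◁ P.F.mapCell (P.F.mapComp _ _) (Iso.refl _) (D.ω₂ X).hom ▷
      P.m (T.F.obj X) ⊗≫
    D.lam X ◁ (P.β (T.F.obj X)).inv ⊗≫ 𝟙 (D.lam X)) = 𝟙 (D.lam X)

/-- The two composites `Pm ∘ λT ∘ Tλ ∘ T²η ⇒ ηT ∘ m` agree. -/
def W8 : Prop := ∀ X : C,
  (𝟙 (T.F.map (T.F.map (P.u X)) ≫ T.F.map (D.lam X) ≫ D.lam (T.F.obj X) ≫
        P.F.map (T.m X)) ⊗≫
    T.F.map (T.F.map (P.u X)) ◁ (D.ω₃ X).hom ⊗≫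
    (T.mNat (P.u X)).hom ▷ D.lam X ⊗≫
    T.m X ◁ (D.ω₂ X).hom ⊗≫ 𝟙 (T.m X ≫ P.u (T.F.obj X))) =
  𝟙 _ ⊗≫
    T.F.mapCell (T.F.mapComp _ _) (Iso.refl _) (D.ω₂ X).hom ▷
      (D.lam (T.F.obj X) ≫ P.F.map (T.m X)) ⊗≫
    (D.ω₂ (T.F.obj X)).hom ▷ P.F.map (T.m X) ⊗≫
    (P.uNat (T.m X)).inv ⊗≫ 𝟙 _

/-- The two composites `Pu ∘ μ ⇒ μT ∘ Pλ ∘ λP ∘ uP²` agree. -/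
def W9 : Prop := ∀ X : C,
  (𝟙 (P.m X ≫ P.F.map (T.u X)) ⊗≫
    P.m X ◁ (D.ω₁ X).hom ⊗≫
    (T.uNat (P.m X)).hom ▷ D.lam X ⊗≫
    T.u (P.F.obj (P.F.obj X)) ◁ (D.ω₄ X).hom ⊗≫
    𝟙 (T.u (P.F.obj (P.F.obj X)) ≫ D.lam (P.F.obj X) ≫ P.F.map (D.lam X) ≫
        P.m (T.F.obj X))) =
  𝟙 _ ⊗≫
    (P.mNat (T.u X)).inv ⊗≫
    P.F.mapCell (Iso.refl _) (P.F.mapComp _ _) (D.ω₁ X).hom ▷ P.m (T.F.obj X) ⊗≫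
    (D.ω₁ (P.F.obj X)).hom ▷ (P.F.map (D.lam X) ≫ P.m (T.F.obj X)) ⊗≫ 𝟙 _

/-- The composite `Pu ∘ η ⇒ λ ∘ uP ∘ η ⇒ λ ∘ Tη ∘ u ⇒ ηT ∘ u` is the pseudonaturality cell
of `η` at `u`. -/
def W10 : Prop := ∀ X : C,
  (𝟙 (P.u X ≫ P.F.map (T.u X)) ⊗≫
    P.u X ◁ (D.ω₁ X).hom ⊗≫
    (T.uNat (P.u X)).hom ▷ D.lam X ⊗≫
    T.u X ◁ (D.ω₂ X).hom ⊗≫ 𝟙 (T.u X ≫ P.u (T.F.obj X))) =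
  (P.uNat (T.u X)).inv

end PseudodistributiveData

/-- A pseudodistributive law (in pseudomonoidal form): the data above subject to the five
coherence axioms `W1`, …, `W5`. -/
structure PseudodistributiveLaw (T P : Pseudomonad C) extends PseudodistributiveData T P where
  w1 : toPseudodistributiveData.W1
  w2 : toPseudodistributiveData.W2
  w3 : toPseudodistributiveData.W3
  w4 : toPseudodistributiveData.W4
  w5 : toPseudodistributiveData.W5

end PseudodistributiveLaw

/-! The argument is close in spirit to Kelly's proof that one unit axiom and the pentagon imply the
other unit axioms of a monoidal category: an equation of 2-cells is tested after an operation that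
loses no information, and there the axioms evaluate it.

There are two such tests. On the `T` side, naturality of `u` turns `TE` whiskered by `u` into `E`
whiskered by `u`, and `u` followed by `λT` and `Pm` is isomorphic to the identity by `ω₁` and `α`;
so a 2-cell `E` with values in `PTX` is determined by `TE` whiskered with `λT` and `Pm`
(`eq_of_cell_whiskerRight_eq`). On the `P` side, `η` and `α^P` play the same role: `E` is determined
by `PE` whiskered with `μ` (`Pseudomonad.eq_of_whiskerLeft_cell_eq`).

With the first test, W6 follows from W1 and W3 (`left_unit_pasting`), and W9 from W1 and W5
(`mul_unit_pasting_left`, `mul_unit_pasting_right`). For W7, the loop at `X` is linked by naturality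
along `η` to the loop at `PX`, which W2 and W4 make trivial after whiskering
(`unit_pasting_natural`, `right_unit_pasting`). The second test then gives W8 from W5 and W7
(`mul_counit_pasting_eq`), and the first test gives W10 from W1 and W8 (`unit_unit_pasting_eq`).

The pasting computations are stated for arbitrary 1-cells of a bicategory, so that `bicategory` has
only coherence to deal with. Images under `T` and `P` enter through `Pseudofunctor.cell`, which
behaves strictly on pastings. -/

/-! ### Images of pasting diagrams under a pseudofunctor. -/

section Cells

variable {C : Type u} [Bicategory.{w, v} C]

/-- The canonical decomposition of `F.map f` along the constraints of a pseudofunctor `F`. -/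
class MapIso (F : C ⥤ᵖ C) {a b : C} (f : a ⟶ b) (p : outParam (F.obj a ⟶ F.obj b)) where
  /-- the canonical isomorphism -/
  iso : F.map f ≅ p

/-- The low priority makes this the fallback, tried after the instances for identities and
composites. -/
instance (priority := low) MapIso.atom (F : C ⥤ᵖ C) {a b : C} (f : a ⟶ b) :
    MapIso F f (F.map f) := ⟨Iso.refl _⟩

instance MapIso.id (F : C ⥤ᵖ C) (a : C) : MapIso F (𝟙 a) (𝟙 (F.obj a)) := ⟨F.mapId a⟩

instance MapIso.comp (F : C ⥤ᵖ C) {a b c : C} (f : a ⟶ b) (g : b ⟶ c)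
    (p : F.obj a ⟶ F.obj b) (q : F.obj b ⟶ F.obj c) [i : MapIso F f p] [j : MapIso F g q] :
    MapIso F (f ≫ g) (p ≫ q) :=
  ⟨F.mapComp f g ≪≫ whiskerRightIso i.iso (F.map g) ≪≫ whiskerLeftIso p j.iso⟩

namespace CategoryTheory.Pseudofunctor

variable (F : C ⥤ᵖ C) {a b c d : C}

/-- The image of a 2-cell, with source and target decomposed canonically. -/
def cell {f f' : a ⟶ b} (θ : f ⟶ f') {p p' : F.obj a ⟶ F.obj b}
    [i : MapIso F f p] [j : MapIso F f' p'] : p ⟶ p' :=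
  i.iso.inv ≫ F.map₂ θ ≫ j.iso.hom

section

variable {f f' f'' : a ⟶ b} {p p' p'' : F.obj a ⟶ F.obj b}
  [MapIso F f p] [MapIso F f' p'] [MapIso F f'' p'']

@[simp]
lemma cell_id : F.cell (𝟙 f) = 𝟙 p := by simp [cell]

lemma cell_congr {θ θ' : f ⟶ f'} (h : θ = θ') : F.cell θ = F.cell θ' := by rw [h]

@[simp]
lemma cell_comp (θ : f ⟶ f') (θ' : f' ⟶ f'') : F.cell (θ ≫ θ') = F.cell θ ≫ F.cell θ' := by
  simp [cell]

-- This and the following `simp` lemmas say that `cell` acts on pastings as a strict functor would.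
-- The image of an axiom under `T` or `P` is then obtained by `simp`.
@[simp]
lemma cell_whiskerLeft {k : c ⟶ a} {q : F.obj c ⟶ F.obj a} [MapIso F k q] (θ : f ⟶ f') :
    F.cell (k ◁ θ) = q ◁ F.cell θ := by
  simp [cell, MapIso.iso, whisker_exchange_assoc]

@[simp]
lemma cell_whiskerRight {k : b ⟶ c} {q : F.obj b ⟶ F.obj c} [MapIso F k q] (θ : f ⟶ f') :
    F.cell (θ ▷ k) = F.cell θ ▷ q := by
  simp [cell, MapIso.iso, whisker_exchange, whisker_exchange_assoc]

end

section

variable {f : a ⟶ b} {g : b ⟶ c} {h : c ⟶ d} {p : F.obj a ⟶ F.obj b} {q : F.obj b ⟶ F.obj c}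
  {r : F.obj c ⟶ F.obj d} [MapIso F f p] [MapIso F g q] [MapIso F h r]

@[simp]
lemma cell_associator_hom : F.cell (α_ f g h).hom = (α_ p q r).hom := by
  rename_i i j k
  have key := whisker_exchange i.iso.hom (j.iso.inv ▷ F.map h)
  simp only [whiskerRight_comp, Category.assoc] at key
  simp [cell, MapIso.iso, whisker_exchange, whisker_exchange_assoc, reassoc_of% key]

@[simp]
lemma cell_associator_inv : F.cell (α_ f g h).inv = (α_ p q r).inv := by
  rw [← cancel_mono (α_ p q r).hom, ← F.cell_associator_hom (f := f) (g := g) (h := h),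
    ← cell_comp]
  simp

@[simp]
lemma cell_leftUnitor_hom : F.cell (λ_ f).hom = (λ_ p).hom := by
  simp [cell, MapIso.iso]

@[simp]
lemma cell_leftUnitor_inv : F.cell (λ_ f).inv = (λ_ p).inv := by
  rw [← cancel_mono (λ_ p).hom, ← F.cell_leftUnitor_hom (f := f), ← cell_comp]; simp

@[simp]
lemma cell_rightUnitor_hom : F.cell (ρ_ f).hom = (ρ_ p).hom := by
  simp [cell, MapIso.iso, whisker_exchange]

@[simp]
lemma cell_rightUnitor_inv : F.cell (ρ_ f).inv = (ρ_ p).inv := by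
  rw [← cancel_mono (ρ_ p).hom, ← F.cell_rightUnitor_hom (f := f), ← cell_comp]; simp

end

/-- The image of an invertible 2-cell, with source and target decomposed canonically. -/
@[simps]
def cellIso {f f' : a ⟶ b} (θ : f ≅ f') {p p' : F.obj a ⟶ F.obj b}
    [i : MapIso F f p] [j : MapIso F f' p'] : p ≅ p' where
  hom := F.cell θ.hom
  inv := F.cell θ.inv
  hom_inv_id := by rw [← cell_comp]; simp
  inv_hom_id := by rw [← cell_comp]; simp

/-- The axioms use `mapCell` with explicit constraints; this family translates each shape that
occurs there into `cell`. -/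
lemma mapCell_comp_id {f : a ⟶ b} {g : b ⟶ a} (θ : f ≫ g ⟶ 𝟙 a) :
    F.mapCell (F.mapComp f g) (F.mapId a) θ = F.cell θ := by
  simp [cell, mapCell, MapIso.iso]

lemma mapCell_id_comp {f : a ⟶ b} {g : b ⟶ a} (θ : 𝟙 a ⟶ f ≫ g) :
    F.mapCell (F.mapId a) (F.mapComp f g) θ = F.cell θ := by
  simp [cell, mapCell, MapIso.iso]

lemma mapCell_comp_comp {f : a ⟶ b} {g : b ⟶ d} {f' : a ⟶ c} {g' : c ⟶ d} (θ : f ≫ g ⟶ f' ≫ g') :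
    F.mapCell (F.mapComp f g) (F.mapComp f' g') θ = F.cell θ := by
  simp [cell, mapCell, MapIso.iso]

lemma mapCell_refl_comp {f : a ⟶ d} {f' : a ⟶ c} {g' : c ⟶ d} (θ : f ⟶ f' ≫ g') :
    F.mapCell (Iso.refl _) (F.mapComp f' g') θ = F.cell θ := by
  simp [cell, mapCell, MapIso.iso]

lemma mapCell_comp_refl {f : a ⟶ b} {g : b ⟶ d} {f' : a ⟶ d} (θ : f ≫ g ⟶ f') :
    F.mapCell (F.mapComp f g) (Iso.refl _) θ = F.cell θ := by
  simp [cell, mapCell, MapIso.iso]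

lemma mapCell_compThree_comp {b' : C} {f : a ⟶ b} {g : b ⟶ c} {h : c ⟶ d} {f' : a ⟶ b'}
    {g' : b' ⟶ d} (θ : f ≫ g ≫ h ⟶ f' ≫ g') :
    F.mapCell (F.mapCompThree f g h) (F.mapComp f' g') θ = F.cell θ := by
  simp [cell, mapCell, mapCompThree, MapIso.iso]

lemma mapCell_comp_compThree {b' : C} {f : a ⟶ b} {g : b ⟶ c} {h : c ⟶ d} {f' : a ⟶ b'}
    {g' : b' ⟶ d} (θ : f' ≫ g' ⟶ f ≫ g ≫ h) :
    F.mapCell (F.mapComp f' g') (F.mapCompThree f g h) θ = F.cell θ := by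
  simp [cell, mapCell, mapCompThree, MapIso.iso]

lemma mapSquare_hom {f : a ⟶ b} {g : b ⟶ d} {f' : a ⟶ c} {g' : c ⟶ d} (θ : f ≫ g ≅ f' ≫ g') :
    (F.mapSquare θ).hom = F.cell θ.hom := by
  simp [cell, mapSquare, MapIso.iso]

end CategoryTheory.Pseudofunctor

end Cells

/-! ### Pseudonaturality cells along decomposed 1-cells. -/

section NaturalityCells

variable {C : Type u} [Bicategory.{w, v} C]

/-- The pasting of two invertible squares along a common transversal `k'`. -/
@[simps!]
def pasteAlong {a b c a' b' c' : C} {f : a ⟶ b} {f' : b ⟶ c} {g : a' ⟶ b'} {g' : b' ⟶ c'}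
    {k : a ⟶ a'} {k' : b ⟶ b'} {k'' : c ⟶ c'} (s : f ≫ k' ≅ k ≫ g) (t : f' ≫ k'' ≅ k' ≫ g') :
    (f ≫ f') ≫ k'' ≅ k ≫ g ≫ g' :=
  α_ f f' k'' ≪≫ whiskerLeftIso f t ≪≫ (α_ f k' g').symm ≪≫ whiskerRightIso s g' ≪≫ α_ k g g'

namespace CategoryTheory.Pseudofunctor.StrongTrans

variable {F G : C ⥤ᵖ C} (σ : StrongTrans F G) {a b c : C}

/-- A pseudonaturality cell, with the images of the 1-cell rewritten along isomorphisms. -/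
def natCell {f : a ⟶ b} {p : F.obj a ⟶ F.obj b} {q : G.obj a ⟶ G.obj b}
    (e : F.map f ≅ p) (e' : G.map f ≅ q) : p ≫ σ.app b ≅ σ.app a ≫ q :=
  whiskerRightIso e.symm _ ≪≫ σ.naturality f ≪≫ whiskerLeftIso _ e'

lemma natCell_refl (f : a ⟶ b) : σ.natCell (Iso.refl _) (Iso.refl _) = σ.naturality f := by
  ext; simp [natCell]

/-- The decompositions of the composite are variables subject to equations because for a composite
pseudofunctor the equation needs `mapIsoTwo_comp`, while for a single one it is `rfl`. -/
lemma natCell_comp {f : a ⟶ b} {g : b ⟶ c} {p : F.obj a ⟶ F.obj b} {q : G.obj a ⟶ G.obj b}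
    {p' : F.obj b ⟶ F.obj c} {q' : G.obj b ⟶ G.obj c} {e : F.map f ≅ p} {e₁ : G.map f ≅ q}
    {e' : F.map g ≅ p'} {e₁' : G.map g ≅ q'} {h : F.map (f ≫ g) ≅ p ≫ p'}
    {h' : G.map (f ≫ g) ≅ q ≫ q'}
    (hh : h = F.mapComp f g ≪≫ whiskerRightIso e _ ≪≫ whiskerLeftIso _ e')
    (hh' : h' = G.mapComp f g ≪≫ whiskerRightIso e₁ _ ≪≫ whiskerLeftIso _ e₁') :
    σ.natCell h h' = pasteAlong (σ.natCell e e₁) (σ.natCell e' e₁') := by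
  subst hh hh'
  ext
  -- The two interchanges needed: `e` slides past the cell of `g`, and `e₁'` past the cell of `f`.
  have h₁ := whisker_exchange e.inv
    (e'.inv ▷ σ.app c ≫ (σ.naturality g).hom ≫ σ.app b ◁ e₁'.hom) =≫ (α_ _ _ _).inv
  have h₂ := (α_ _ _ _).inv ≫= whisker_exchange (σ.naturality f).hom e₁'.hom
  simp only [whiskerRight_comp, comp_whiskerLeft, whiskerLeft_comp, Category.assoc,
    Iso.hom_inv_id, Iso.inv_hom_id_assoc, Category.comp_id] at h₁ h₂
  simp [natCell, pasteAlong, whisker_exchange_assoc, reassoc_of% h₁, reassoc_of% h₂]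
  simp only [← whiskerLeft_comp, whisker_exchange]

lemma natCell_id (h : F.map (𝟙 a) ≅ 𝟙 _) (h' : G.map (𝟙 a) ≅ 𝟙 _)
    (hh : h = F.mapId a) (hh' : h' = G.mapId a) :
    σ.natCell h h' = (idSquare (σ.app a)).symm := by
  subst hh hh'
  ext
  simp [natCell, idSquare]

lemma natCell_naturality {f f' : a ⟶ b} (θ : f ⟶ f') {p p' : F.obj a ⟶ F.obj b}
    {q q' : G.obj a ⟶ G.obj b} (e : F.map f ≅ p) (e₁ : G.map f ≅ q)
    (e' : F.map f' ≅ p') (e₁' : G.map f' ≅ q') :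
    (e.inv ≫ F.map₂ θ ≫ e'.hom) ▷ σ.app b ≫ (σ.natCell e' e₁').hom =
      (σ.natCell e e₁).hom ≫ σ.app a ◁ (e₁.inv ≫ G.map₂ θ ≫ e₁'.hom) := by
  simp [natCell]

end CategoryTheory.Pseudofunctor.StrongTrans

namespace CategoryTheory.Pseudofunctor

variable (F G : C ⥤ᵖ C) {a b c : C}

/-- The image of an invertible 2-cell. -/
@[simps]
def imageIso {f f' : a ⟶ b} (θ : f ≅ f') : G.map f ≅ G.map f' where
  hom := G.map₂ θ.hom
  inv := G.map₂ θ.inv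

/-- The canonical decomposition of `G.map (F.map f)`. -/
abbrev mapIsoTwo (f : a ⟶ b) {p q} [i : MapIso F f p] [j : MapIso G p q] :
    G.map (F.map f) ≅ q :=
  G.imageIso i.iso ≪≫ j.iso

lemma mapIsoTwo_atom (f : a ⟶ b) : F.mapIsoTwo G f = Iso.refl (G.map (F.map f)) := by
  ext
  simp [MapIso.iso]

lemma mapIsoTwo_comp (f : a ⟶ b) (g : b ⟶ c) {p q p' q'} [i : MapIso F f p] [j : MapIso G p q]
    [i' : MapIso F g p'] [j' : MapIso G p' q'] :
    F.mapIsoTwo G (f ≫ g) = (G.imageIso (F.mapComp f g) ≪≫ G.mapComp _ _) ≪≫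
      whiskerRightIso (F.mapIsoTwo G f) _ ≪≫ whiskerLeftIso _ (F.mapIsoTwo G g) := by
  ext
  simp [MapIso.iso, whisker_exchange_assoc]

lemma cell_cell {f f' : a ⟶ b} (θ : f ⟶ f') {p q p' q'} [i : MapIso F f p] [j : MapIso G p q]
    [i' : MapIso F f' p'] [j' : MapIso G p' q'] :
    G.cell (F.cell θ) = (F.mapIsoTwo G f).inv ≫ G.map₂ (F.map₂ θ) ≫ (F.mapIsoTwo G f').hom := by
  simp [cell]

end CategoryTheory.Pseudofunctor

namespace DistributorData

variable {T P : Pseudomonad C} (D : DistributorData T P)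

/-- The pseudonaturality cell of `λ`, with images decomposed canonically. -/
def lamCell {a b : C} (f : a ⟶ b) {p q r s} [i : MapIso P.F f p] [j : MapIso T.F p q]
    [k : MapIso T.F f r] [l : MapIso P.F r s] : q ≫ D.lam b ≅ D.lam a ≫ s :=
  D.trans.natCell (f := f) (P.F.mapIsoTwo T.F f) (T.F.mapIsoTwo P.F f)

section

variable {a b c : C} {f f' : a ⟶ b} {p q r s p' q' r' s'}
    [i : MapIso P.F f p] [j : MapIso T.F p q] [k : MapIso T.F f r] [l : MapIso P.F r s]
    [i' : MapIso P.F f' p'] [j' : MapIso T.F p' q'] [k' : MapIso T.F f' r'] [l' : MapIso P.F r' s']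

/-- Naturality of `λ` in 2-cells. Applied to `α`, `α^P`, `ω₁`, `ω₂` and a cell of `η`, it exchanges
the `TP`-image of such a cell for its `PT`-image; `lamCell_comp` and `lamCell_id` then split the
boundary into the cells that occur in the axioms. -/
lemma lamCell_naturality (θ : f ⟶ f') :
    T.F.cell (P.F.cell θ) ▷ D.lam b ≫ (D.lamCell f').hom =
      (D.lamCell f).hom ≫ D.lam a ◁ P.F.cell (T.F.cell θ) := by
  rw [Pseudofunctor.cell_cell, Pseudofunctor.cell_cell]
  exact D.trans.natCell_naturality θ _ _ _ _

end

lemma lamCell_atom {a b : C} (f : a ⟶ b) : D.lamCell f = D.lamNat f :=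
  (congrArg₂ (D.trans.natCell (f := f)) (P.F.mapIsoTwo_atom T.F f)
    (T.F.mapIsoTwo_atom P.F f)).trans (D.trans.natCell_refl f)

lemma lamCell_id (a : C) : D.lamCell (𝟙 a) = (idSquare (D.lam a)).symm :=
  D.trans.natCell_id _ _ rfl rfl

lemma lamCell_comp {a b c : C} (f : a ⟶ b) (g : b ⟶ c) {p q r s p' q' r' s'}
    [i : MapIso P.F f p] [j : MapIso T.F p q] [k : MapIso T.F f r] [l : MapIso P.F r s]
    [i' : MapIso P.F g p'] [j' : MapIso T.F p' q'] [k' : MapIso T.F g r'] [l' : MapIso P.F r' s'] :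
    D.lamCell (f ≫ g) = pasteAlong (D.lamCell f) (D.lamCell g) :=
  D.trans.natCell_comp (P.F.mapIsoTwo_comp T.F f g) (T.F.mapIsoTwo_comp P.F f g)

end DistributorData

namespace PseudomonadData

variable (T : PseudomonadData C) {a b c : C}

/-- The pseudonaturality cell of `m`, with images decomposed canonically. -/
def mCell (f : a ⟶ b) {p q} [i : MapIso T.F f p] [j : MapIso T.F p q] :
    q ≫ T.m b ≅ T.m a ≫ p :=
  T.mul.natCell (f := f) (T.F.mapIsoTwo T.F f) i.iso

/-- The pseudonaturality cell of `u`, with images decomposed canonically. -/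
def uCell (f : a ⟶ b) {p} [i : MapIso T.F f p] : f ≫ T.u b ≅ T.u a ≫ p :=
  T.unit.natCell (f := f) (Iso.refl _) i.iso

lemma mCell_naturality {f f' : a ⟶ b} (θ : f ⟶ f') {p q p' q'} [i : MapIso T.F f p]
    [j : MapIso T.F p q] [i' : MapIso T.F f' p'] [j' : MapIso T.F p' q'] :
    T.F.cell (T.F.cell θ) ▷ T.m b ≫ (T.mCell f').hom =
      (T.mCell f).hom ≫ T.m a ◁ T.F.cell θ := by
  rw [Pseudofunctor.cell_cell]
  exact T.mul.natCell_naturality θ _ _ _ _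

lemma uCell_naturality {f f' : a ⟶ b} (θ : f ⟶ f') {p p'} [i : MapIso T.F f p]
    [i' : MapIso T.F f' p'] :
    θ ▷ T.u b ≫ (T.uCell f').hom = (T.uCell f).hom ≫ T.u a ◁ T.F.cell θ := by
  have h : (Iso.refl f).inv ≫ θ ≫ (Iso.refl f').hom = θ := by simp
  conv_lhs => rw [← h]
  exact T.unit.natCell_naturality θ _ _ _ _

lemma mCell_atom (f : a ⟶ b) : T.mCell f = T.mNat f :=
  (congrArg₂ (T.mul.natCell (f := f)) (T.F.mapIsoTwo_atom T.F f) rfl).trans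
    (T.mul.natCell_refl f)

lemma uCell_atom (f : a ⟶ b) : T.uCell f = T.uNat f :=
  T.unit.natCell_refl f

lemma mCell_id (a : C) : T.mCell (𝟙 a) = (idSquare (T.m a)).symm :=
  T.mul.natCell_id _ _ rfl rfl

lemma uCell_id (a : C) : T.uCell (𝟙 a) = (idSquare (T.u a)).symm :=
  T.unit.natCell_id _ _ rfl rfl

lemma mCell_comp (f : a ⟶ b) (g : b ⟶ c) {p q p' q'} [i : MapIso T.F f p] [j : MapIso T.F p q]
    [i' : MapIso T.F g p'] [j' : MapIso T.F p' q'] :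
    T.mCell (f ≫ g) = pasteAlong (T.mCell f) (T.mCell g) :=
  T.mul.natCell_comp (T.F.mapIsoTwo_comp T.F f g) rfl

lemma uCell_comp (f : a ⟶ b) (g : b ⟶ c) {p p'} [i : MapIso T.F f p] [i' : MapIso T.F g p'] :
    T.uCell (f ≫ g) = pasteAlong (T.uCell f) (T.uCell g) := by
  refine T.unit.natCell_comp ?_ rfl
  -- The constraints of the identity pseudofunctor are identities by definition.
  change Iso.refl (f ≫ g) = Iso.refl (f ≫ g) ≪≫ whiskerRightIso (Iso.refl f) g ≪≫
    whiskerLeftIso f (Iso.refl g)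
  ext
  simp

end PseudomonadData

end NaturalityCells

/-! ### W6, from W1 and W3. -/

section Pasting

variable {C : Type u} [Bicategory.{w, v} C]

/-- All factors of the loop in W1 are invertible, so it can be solved for the part formed by `Tω₁`
and `ω₃`, which is what appears inside larger pastings. -/
lemma unit_pasting_of_eq_id {a b c d e : C} {l : a ⟶ b} {ptu : b ⟶ c} {pm : c ⟶ b}
    {tpu : a ⟶ d} {l' : d ⟶ c} {tu : a ⟶ e} {tl : e ⟶ d} {m : e ⟶ a}
    (pb : 𝟙 b ≅ ptu ≫ pm) (n : tpu ≫ l' ≅ l ≫ ptu) (w : tpu ≅ tu ≫ tl)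
    (o : tl ≫ l' ≫ pm ≅ m ≫ l) (β : 𝟙 a ≅ tu ≫ m)
    (h : (𝟙 l ⊗≫ l ◁ pb.hom ⊗≫ n.inv ▷ pm ⊗≫ w.hom ▷ (l' ≫ pm) ⊗≫ tu ◁ o.hom ⊗≫
      β.inv ▷ l ⊗≫ 𝟙 l) = 𝟙 l) :
    w.hom ▷ (l' ≫ pm) ⊗≫ tu ◁ o.hom =
      𝟙 _ ⊗≫ n.hom ▷ pm ⊗≫ l ◁ pb.inv ⊗≫ β.hom ▷ l ⊗≫ 𝟙 _ := by
  calc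
    _ = 𝟙 _ ⊗≫ (n.hom ▷ pm ≫ n.inv ▷ pm) ⊗≫ w.hom ▷ (l' ≫ pm) ⊗≫ tu ◁ o.hom ⊗≫ 𝟙 _ := by
      rw [hom_inv_whiskerRight]; bicategory
    _ = 𝟙 _ ⊗≫ n.hom ▷ pm ⊗≫ l ◁ (pb.inv ≫ pb.hom) ⊗≫ n.inv ▷ pm ⊗≫ w.hom ▷ (l' ≫ pm) ⊗≫
        tu ◁ o.hom ⊗≫ (β.inv ≫ β.hom) ▷ l ⊗≫ 𝟙 _ := by
      rw [Iso.inv_hom_id, Iso.inv_hom_id]; bicategory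
    _ = 𝟙 _ ⊗≫ n.hom ▷ pm ⊗≫ l ◁ pb.inv ⊗≫ (𝟙 l ⊗≫ l ◁ pb.hom ⊗≫ n.inv ▷ pm ⊗≫
        w.hom ▷ (l' ≫ pm) ⊗≫ tu ◁ o.hom ⊗≫ β.inv ▷ l ⊗≫ 𝟙 l) ⊗≫ β.hom ▷ l ⊗≫ 𝟙 _ := by
      bicategory
    _ = _ := by
      rw [h]; bicategory

/-- The unit pasting of `W6`, whiskered by `T` and `λT ≫ Pm`, is trivial. -/
lemma left_unit_pasting {a b c d e f g h k : C} {L : a ⟶ b} {l₁ : b ⟶ c} {pm : c ⟶ d}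
    {ptu : c ⟶ h} {ptm pmT : h ⟶ c} {tpu : b ⟶ g} {tpm : g ⟶ b} {l₂ : g ⟶ h}
    {tuPT : b ⟶ f} {tl₁ : f ⟶ g} {mPT : f ⟶ b} {tuTP : a ⟶ e} {ttl : e ⟶ f}
    {tmP mTP : e ⟶ a} {mP : a ⟶ k} {l : k ⟶ d}
    (pta : ptu ≫ ptm ≅ 𝟙 c) (tpa : tpu ≫ tpm ≅ 𝟙 b) (nu : tpu ≫ l₂ ≅ l₁ ≫ ptu)
    (nm : tpm ≫ l₁ ≅ l₂ ≫ ptm) (w₁ : tpu ≅ tuPT ≫ tl₁) (tun : L ≫ tuPT ≅ tuTP ≫ ttl)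
    (o₃ : ttl ≫ tl₁ ≫ tpm ≅ tmP ≫ L) (o : L ≫ l₁ ≫ pm ≅ mP ≫ l)
    (o₁ : tl₁ ≫ l₂ ≫ pmT ≅ mPT ≫ l₁) (γ : tmP ≫ mP ≅ mTP ≫ mP) (pg : ptm ≫ pm ≅ pmT ≫ pm)
    (mn : ttl ≫ mPT ≅ mTP ≫ L) (ta : tuTP ≫ tmP ≅ 𝟙 a) (b₁ : 𝟙 a ≅ tuTP ≫ mTP)
    (b₂ : 𝟙 b ≅ tuPT ≫ mPT) (pb : 𝟙 c ≅ ptu ≫ pmT)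
    (hN : tpa.inv ▷ l₁ = 𝟙 _ ⊗≫ l₁ ◁ pta.inv ⊗≫ nu.inv ▷ ptm ⊗≫ tpu ◁ nm.inv ⊗≫ 𝟙 _)
    (h₃ : (𝟙 (ttl ≫ tl₁ ≫ l₂ ≫ ptm ≫ pm) ⊗≫ (ttl ≫ tl₁) ◁ nm.inv ▷ pm ⊗≫
        o₃.hom ▷ (l₁ ≫ pm) ⊗≫ tmP ◁ o.hom ⊗≫ γ.hom ▷ l ⊗≫ 𝟙 (mTP ≫ mP ≫ l)) =
      𝟙 _ ⊗≫ (ttl ≫ tl₁ ≫ l₂) ◁ pg.hom ⊗≫ ttl ◁ o₁.hom ▷ pm ⊗≫ mn.hom ▷ (l₁ ≫ pm) ⊗≫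
        mTP ◁ o.hom ⊗≫ 𝟙 _)
    (h₁ : w₁.hom ▷ (l₂ ≫ pmT) ⊗≫ tuPT ◁ o₁.hom =
      𝟙 _ ⊗≫ nu.hom ▷ pmT ⊗≫ l₁ ◁ pb.inv ⊗≫ b₂.hom ▷ l₁ ⊗≫ 𝟙 _)
    (hu : tuTP ◁ γ.hom = 𝟙 _ ⊗≫ ta.hom ▷ mP ⊗≫ b₁.hom ▷ mP ⊗≫ 𝟙 _)
    (hpu : ptu ◁ pg.hom = 𝟙 _ ⊗≫ pta.hom ▷ pm ⊗≫ pb.hom ▷ pm ⊗≫ 𝟙 _)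
    (hb : L ◁ b₂.hom ⊗≫ tun.hom ▷ mPT ⊗≫ tuTP ◁ mn.hom = 𝟙 _ ⊗≫ b₁.hom ▷ L ⊗≫ 𝟙 _) :
    (𝟙 L ⊗≫ L ◁ tpa.inv ⊗≫ L ◁ w₁.hom ▷ tpm ⊗≫ tun.hom ▷ (tl₁ ≫ tpm) ⊗≫
      tuTP ◁ o₃.hom ⊗≫ ta.hom ▷ L ⊗≫ 𝟙 L) ▷ (l₁ ≫ pm) = 𝟙 _ := by
  -- Composing with `ω₃` supplies the second occurrence of `ω₃` in W3. Composing with `β` makes `Tα`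
  -- be followed by `β`, which the unit axiom identifies with a whiskered `γ`.
  rw [← cancel_mono o.hom, ← cancel_mono ((λ_ _).inv ≫ b₁.hom ▷ (mP ≫ l))]
  calc
    _ = 𝟙 _ ⊗≫ L ◁ (tpa.inv ▷ l₁) ▷ pm ⊗≫ L ◁ w₁.hom ▷ (tpm ≫ l₁ ≫ pm) ⊗≫
        tun.hom ▷ (tl₁ ≫ tpm ≫ l₁ ≫ pm) ⊗≫ tuTP ◁ o₃.hom ▷ (l₁ ≫ pm) ⊗≫
        (ta.hom ▷ (L ≫ l₁ ≫ pm) ≫ 𝟙 a ◁ o.hom) ⊗≫ b₁.hom ▷ (mP ≫ l) := by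
      bicategory
    _ = 𝟙 _ ⊗≫ L ◁ l₁ ◁ pta.inv ▷ pm ⊗≫ L ◁ nu.inv ▷ (ptm ≫ pm) ⊗≫
        (L ◁ tpu ◁ nm.inv ▷ pm ≫ L ◁ w₁.hom ▷ ((tpm ≫ l₁) ≫ pm)) ⊗≫
        tun.hom ▷ (tl₁ ≫ tpm ≫ l₁ ≫ pm) ⊗≫ tuTP ◁ o₃.hom ▷ (l₁ ≫ pm) ⊗≫
        (tuTP ≫ tmP) ◁ o.hom ⊗≫ ta.hom ▷ (mP ≫ l) ⊗≫ b₁.hom ▷ (mP ≫ l) := by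
      rw [hN, ← whisker_exchange]; bicategory
    _ = 𝟙 _ ⊗≫ L ◁ l₁ ◁ pta.inv ▷ pm ⊗≫ L ◁ nu.inv ▷ (ptm ≫ pm) ⊗≫
        L ◁ w₁.hom ▷ (l₂ ≫ ptm ≫ pm) ⊗≫
        ((L ≫ tuPT) ◁ (tl₁ ◁ nm.inv ▷ pm) ≫ tun.hom ▷ (tl₁ ≫ (tpm ≫ l₁) ≫ pm)) ⊗≫
        tuTP ◁ o₃.hom ▷ (l₁ ≫ pm) ⊗≫
        (tuTP ≫ tmP) ◁ o.hom ⊗≫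
        (𝟙 (tuTP ≫ tmP ≫ mP) ⊗≫ ta.hom ▷ mP ⊗≫ b₁.hom ▷ mP ⊗≫ 𝟙 (tuTP ≫ mTP ≫ mP)) ▷ l ⊗≫ 𝟙 _ := by
      rw [← whiskerLeft_comp, whisker_exchange]; bicategory
    -- The unit axiom has produced `γ`, and the bracket is the first composite of W3.
    _ = 𝟙 _ ⊗≫ L ◁ l₁ ◁ pta.inv ▷ pm ⊗≫ L ◁ nu.inv ▷ (ptm ≫ pm) ⊗≫
        L ◁ w₁.hom ▷ (l₂ ≫ ptm ≫ pm) ⊗≫ tun.hom ▷ (tl₁ ≫ l₂ ≫ ptm ≫ pm) ⊗≫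
        tuTP ◁ (𝟙 (ttl ≫ tl₁ ≫ l₂ ≫ ptm ≫ pm) ⊗≫ (ttl ≫ tl₁) ◁ nm.inv ▷ pm ⊗≫
          o₃.hom ▷ (l₁ ≫ pm) ⊗≫ tmP ◁ o.hom ⊗≫ γ.hom ▷ l ⊗≫ 𝟙 (mTP ≫ mP ≫ l)) ⊗≫ 𝟙 _ := by
      rw [whisker_exchange, ← hu]; bicategory
    _ = 𝟙 _ ⊗≫ L ◁ l₁ ◁ pta.inv ▷ pm ⊗≫ L ◁ nu.inv ▷ (ptm ≫ pm) ⊗≫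
        L ◁ w₁.hom ▷ (l₂ ≫ ptm ≫ pm) ⊗≫
        (tun.hom ▷ (tl₁ ≫ l₂ ≫ ptm ≫ pm) ≫ (tuTP ≫ ttl) ◁ (tl₁ ◁ l₂ ◁ pg.hom)) ⊗≫
        tuTP ◁ ttl ◁ o₁.hom ▷ pm ⊗≫ tuTP ◁ mn.hom ▷ (l₁ ≫ pm) ⊗≫
        tuTP ◁ mTP ◁ o.hom ⊗≫ 𝟙 _ := by
      rw [h₃]; bicategory
    _ = 𝟙 _ ⊗≫ L ◁ l₁ ◁ pta.inv ▷ pm ⊗≫ L ◁ nu.inv ▷ (ptm ≫ pm) ⊗≫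
        L ◁ (w₁.hom ▷ (l₂ ≫ ptm ≫ pm) ≫ (tuPT ≫ tl₁) ◁ (l₂ ◁ pg.hom)) ⊗≫
        (tun.hom ▷ (tl₁ ≫ l₂ ≫ pmT ≫ pm) ≫ (tuTP ≫ ttl) ◁ (𝟙 _ ⊗≫ o₁.hom ▷ pm)) ⊗≫
        tuTP ◁ mn.hom ▷ (l₁ ≫ pm) ⊗≫ tuTP ◁ mTP ◁ o.hom ⊗≫ 𝟙 _ := by
      rw [← whisker_exchange]; bicategory
    _ = 𝟙 _ ⊗≫ L ◁ l₁ ◁ pta.inv ▷ pm ⊗≫ L ◁ (nu.inv ▷ (ptm ≫ pm) ≫ (tpu ≫ l₂) ◁ pg.hom) ⊗≫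
        L ◁ w₁.hom ▷ (l₂ ≫ pmT ≫ pm) ⊗≫ L ◁ tuPT ◁ o₁.hom ▷ pm ⊗≫ tun.hom ▷ (mPT ≫ l₁ ≫ pm) ⊗≫
        tuTP ◁ mn.hom ▷ (l₁ ≫ pm) ⊗≫ tuTP ◁ mTP ◁ o.hom ⊗≫ 𝟙 _ := by
      rw [← whisker_exchange, ← whisker_exchange]; bicategory
    _ = 𝟙 _ ⊗≫ L ◁ l₁ ◁ pta.inv ▷ pm ⊗≫ L ◁ l₁ ◁ (ptu ◁ pg.hom) ⊗≫ L ◁ nu.inv ▷ (pmT ≫ pm) ⊗≫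
        L ◁ (w₁.hom ▷ (l₂ ≫ pmT) ⊗≫ tuPT ◁ o₁.hom) ▷ pm ⊗≫ tun.hom ▷ (mPT ≫ l₁ ≫ pm) ⊗≫
        tuTP ◁ mn.hom ▷ (l₁ ≫ pm) ⊗≫ tuTP ◁ mTP ◁ o.hom ⊗≫ 𝟙 _ := by
      rw [← whisker_exchange]; bicategory
    _ = 𝟙 _ ⊗≫ L ◁ l₁ ◁ (pta.inv ≫ pta.hom) ▷ pm ⊗≫ L ◁ l₁ ◁ pb.hom ▷ pm ⊗≫
        L ◁ (nu.inv ≫ nu.hom) ▷ (pmT ≫ pm) ⊗≫ L ◁ l₁ ◁ pb.inv ▷ pm ⊗≫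
        L ◁ b₂.hom ▷ (l₁ ≫ pm) ⊗≫ tun.hom ▷ (mPT ≫ l₁ ≫ pm) ⊗≫
        tuTP ◁ mn.hom ▷ (l₁ ≫ pm) ⊗≫ tuTP ◁ mTP ◁ o.hom ⊗≫ 𝟙 _ := by
      rw [h₁, hpu]; bicategory
    -- The surviving bracket is `β` carried along `λ`, which the modification property of `β`
    -- evaluates.
    _ = 𝟙 _ ⊗≫ L ◁ l₁ ◁ (pb.hom ≫ pb.inv) ▷ pm ⊗≫
        (L ◁ b₂.hom ⊗≫ tun.hom ▷ mPT ⊗≫ tuTP ◁ mn.hom) ▷ (l₁ ≫ pm) ⊗≫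
        tuTP ◁ mTP ◁ o.hom ⊗≫ 𝟙 _ := by
      rw [Iso.inv_hom_id, Iso.inv_hom_id]; bicategory
    _ = 𝟙 _ ⊗≫ (b₁.hom ▷ (L ≫ l₁ ≫ pm) ≫ (tuTP ≫ mTP) ◁ o.hom) ⊗≫ 𝟙 _ := by
      rw [hb, Iso.hom_inv_id]; bicategory
    _ = _ := by
      rw [← whisker_exchange]; bicategory

end Pasting

section LeftUnit

variable {C : Type u} [Bicategory.{w, v} C]

/-- The modification axiom of `β` as an equation of pastings. -/
lemma Pseudomonad.β_square (T : Pseudomonad C) {X Y : C} (f : X ⟶ Y) :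
    T.F.map f ◁ (T.β Y).hom ⊗≫ T.F.cell (T.uNat f).hom ▷ T.m Y ⊗≫
        T.F.map (T.u X) ◁ (T.mNat f).hom =
      𝟙 _ ⊗≫ (T.β X).hom ▷ T.F.map f ⊗≫ 𝟙 _ := by
  have h := T.β_modification f =≫ (α_ _ _ _).hom
  simp only [pasteSquare, idSquare, Iso.trans_hom, Iso.symm_hom, whiskerLeftIso_hom,
    whiskerRightIso_hom, Pseudofunctor.mapSquare_hom, Category.assoc, Iso.inv_hom_id,
    Category.comp_id] at h
  simp [bicategoricalComp, h]

namespace PseudodistributiveLaw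

variable {T P : Pseudomonad C} (D : PseudodistributiveLaw T P)

/-- A solved form of `W1`. -/
lemma w1_solved (X : C) :
    T.F.cell (D.ω₁ X).hom ▷ (D.lam (T.F.obj X) ≫ P.F.map (T.m X)) ⊗≫
        T.F.map (T.u (P.F.obj X)) ◁ (D.ω₃ X).hom =
      𝟙 _ ⊗≫ (D.lamNat (T.u X)).hom ▷ P.F.map (T.m X) ⊗≫ D.lam X ◁ P.F.cell (T.β X).inv ⊗≫
        (T.β (P.F.obj X)).hom ▷ D.lam X ⊗≫ 𝟙 _ := by
  have h := D.w1 X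
  rw [Pseudofunctor.mapCell_id_comp, Pseudofunctor.mapCell_refl_comp] at h
  exact unit_pasting_of_eq_id (P.F.cellIso (T.β X)) (D.lamNat (T.u X)) (T.F.cellIso (D.ω₁ X))
    (D.ω₃ X) (T.β (P.F.obj X)) h

/-- Whiskering the hypothesis with `u` and using naturality of `u` gives equality after whiskering
with `u`, `λT`, `Pm`; that composite is isomorphic to an identity by `ω₁` and `α`, so the whiskering
can be removed. -/
lemma eq_of_cell_whiskerRight_eq {A X : C} {f g : A ⟶ P.F.obj (T.F.obj X)} {E E' : f ⟶ g}
    {p q} [MapIso T.F f p] [MapIso T.F g q]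
    (h : T.F.cell E ▷ (D.lam (T.F.obj X) ≫ P.F.map (T.m X)) =
      T.F.cell E' ▷ (D.lam (T.F.obj X) ≫ P.F.map (T.m X))) : E = E' := by
  have h₁ : E ▷ (T.u _ ≫ D.lam (T.F.obj X) ≫ P.F.map (T.m X)) =
      E' ▷ (T.u _ ≫ D.lam (T.F.obj X) ≫ P.F.map (T.m X)) := by
    rw [← cancel_mono ((α_ _ _ _).inv ≫ (T.uCell g).hom ▷ _ ≫ (α_ _ _ _).hom)]
    have e : ∀ E : f ⟶ g, E ▷ (T.u _ ≫ D.lam (T.F.obj X) ≫ P.F.map (T.m X)) ≫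
        (α_ _ _ _).inv ≫ (T.uCell g).hom ▷ _ ≫ (α_ _ _ _).hom =
        (α_ _ _ _).inv ≫ (T.uCell f).hom ▷ _ ≫ (α_ _ _ _).hom ≫
          T.u A ◁ T.F.cell E ▷ (D.lam (T.F.obj X) ≫ P.F.map (T.m X)) := by
      intro E
      calc
        _ = 𝟙 _ ⊗≫ (E ▷ T.u _ ≫ (T.uCell g).hom) ▷ (D.lam (T.F.obj X) ≫ P.F.map (T.m X)) ⊗≫
            𝟙 _ := by bicategory
        _ = _ := by rw [T.uCell_naturality]; bicategory
    rw [e, e, h]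
  let i : T.u _ ≫ D.lam (T.F.obj X) ≫ P.F.map (T.m X) ≅ 𝟙 _ :=
    (α_ _ _ _).symm ≪≫ whiskerRightIso (D.ω₁ (T.F.obj X)).symm _ ≪≫ P.F.cellIso (T.α X)
  have e : ∀ E : f ⟶ g, E = (ρ_ f).inv ≫ f ◁ i.inv ≫
      E ▷ (T.u _ ≫ D.lam (T.F.obj X) ≫ P.F.map (T.m X)) ≫ g ◁ i.hom ≫ (ρ_ g).hom := by
    intro E
    rw [← whisker_exchange_assoc]
    simp
  rw [e E, e E', h₁]

theorem w6 : D.W6 := by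
  intro X
  rw [Pseudofunctor.mapCell_id_comp]
  apply D.eq_of_cell_whiskerRight_eq
  have key := left_unit_pasting (P.F.cellIso (T.F.cellIso (T.α X)))
    (T.F.cellIso (P.F.cellIso (T.α X))) (D.lamNat (T.u (T.F.obj X))) (D.lamNat (T.m X))
    (T.F.cellIso (D.ω₁ (T.F.obj X))) (T.F.cellIso (T.uNat (D.lam X))) (T.F.cellIso (D.ω₃ X))
    (D.ω₃ X) (D.ω₃ (T.F.obj X)) (T.γ (P.F.obj X)) (P.F.cellIso (T.γ X)) (T.mNat (D.lam X))
    (T.F.cellIso (T.α (P.F.obj X))) (T.β (T.F.obj (P.F.obj X))) (T.β (P.F.obj (T.F.obj X)))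
    (P.F.cellIso (T.β (T.F.obj X))) ?_ ?_ ?_ ?_ ?_ ?_
  · refine Eq.trans ?_ (key.trans ?_)
    · congr 1
      simp [bicategoricalComp]
    · simp
  -- Naturality of `λ` at `α⁻¹` trades `TPα⁻¹` for `PTα⁻¹`.
  · have := D.lamCell_naturality (T.α X).inv
    rw [D.lamCell_comp, D.lamCell_id, D.lamCell_atom, D.lamCell_atom,
      ← Iso.eq_comp_inv] at this
    simp only [Pseudofunctor.cellIso_inv]
    rw [this]
    simp only [idSquare, pasteAlong_inv, Iso.trans_symm, Iso.symm_symm_eq, Iso.trans_hom, Iso.symm_hom]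
    bicategory
  · have := D.w3 X
    simpa only [Pseudofunctor.mapCell_compThree_comp, Pseudofunctor.mapCell_comp_comp,
      Pseudofunctor.cellIso_hom] using this
  · exact D.w1_solved (T.F.obj X)
  · have := Pseudomonad.unit_axiom T (P.F.obj X)
    simpa only [Pseudofunctor.mapCell_comp_id, Pseudofunctor.cellIso_hom] using this
  · have := P.F.cell_congr (Pseudomonad.unit_axiom T X)
    simp only [Pseudofunctor.mapCell_comp_id] at this
    simp [bicategoricalComp] at this
    simp [bicategoricalComp, this]
  · exact T.β_square (D.lam X)

end PseudodistributiveLaw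

end LeftUnit

/-! ### W9, from W1 and W5. -/

section Pasting

variable {C : Type u} [Bicategory.{w, v} C]

/-- Evaluation of one side of `W9`, whiskered by `T`, through the axiom `W5`. -/
lemma mul_unit_pasting_left {a b c d e k e₂ f₂ g₂ h₂ i₂ j₂ n q : C}
    {tm : a ⟶ k} {tpu : k ⟶ b} {l : k ⟶ d} {l₁ : b ⟶ c} {pm : c ⟶ d} {ptu : d ⟶ c}
    {tuP : k ⟶ e} {tl : e ⟶ b} {mP : e ⟶ k} {tuPP : a ⟶ e₂} {ttm : e₂ ⟶ e} {mPP : e₂ ⟶ a}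
    {tlP : e₂ ⟶ f₂} {tpl : f₂ ⟶ g₂} {tmT : g₂ ⟶ b} {lPT : g₂ ⟶ h₂} {pl₁ : h₂ ⟶ i₂}
    {mTT : i₂ ⟶ c} {lTP : f₂ ⟶ j₂} {ptl : j₂ ⟶ h₂} {ppm : i₂ ⟶ n} {μT : n ⟶ d}
    {lP : a ⟶ q} {pl : q ⟶ n} {pmP : j₂ ⟶ q}
    (w₁ : tpu ≅ tuP ≫ tl) (o₃ : tl ≫ l₁ ≫ pm ≅ mP ≫ l) (nu : tpu ≫ l₁ ≅ l ≫ ptu)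
    (pb : 𝟙 d ≅ ptu ≫ pm) (bP : 𝟙 k ≅ tuP ≫ mP) (bPP : 𝟙 a ≅ tuPP ≫ mPP)
    (un : tm ≫ tuP ≅ tuPP ≫ ttm) (mn : ttm ≫ mP ≅ mPP ≫ tm)
    (o₄ : tm ≫ l ≅ lP ≫ pl ≫ μT) (to₄ : ttm ≫ tl ≅ tlP ≫ tpl ≫ tmT)
    (o₄T : tmT ≫ l₁ ≅ lPT ≫ pl₁ ≫ mTT) (ln : tpl ≫ lPT ≅ lTP ≫ ptl)
    (nm : ppm ≫ μT ≅ mTT ≫ pm) (po₃ : ptl ≫ pl₁ ≫ ppm ≅ pmP ≫ pl)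
    (o₃P : tlP ≫ lTP ≫ pmP ≅ mPP ≫ lP)
    (h₁ : w₁.hom ▷ (l₁ ≫ pm) ⊗≫ tuP ◁ o₃.hom =
      𝟙 _ ⊗≫ nu.hom ▷ pm ⊗≫ l ◁ pb.inv ⊗≫ bP.hom ▷ l ⊗≫ 𝟙 _)
    (hb : tm ◁ bP.hom ⊗≫ un.hom ▷ mP ⊗≫ tuPP ◁ mn.hom = 𝟙 _ ⊗≫ bPP.hom ▷ tm ⊗≫ 𝟙 _)
    (h₅ : (𝟙 (ttm ≫ tl ≫ l₁ ≫ pm) ⊗≫ to₄.hom ▷ (l₁ ≫ pm) ⊗≫ (tlP ≫ tpl) ◁ o₄T.hom ▷ pm ⊗≫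
        tlP ◁ ln.hom ▷ (pl₁ ≫ mTT ≫ pm) ⊗≫ (tlP ≫ lTP ≫ ptl ≫ pl₁) ◁ nm.inv ⊗≫
        (tlP ≫ lTP) ◁ po₃.hom ▷ μT ⊗≫ o₃P.hom ▷ (pl ≫ μT) ⊗≫ 𝟙 (mPP ≫ lP ≫ pl ≫ μT)) =
      𝟙 _ ⊗≫ ttm ◁ o₃.hom ⊗≫ mn.hom ▷ l ⊗≫ mPP ◁ o₄.hom ⊗≫ 𝟙 _) :
    (𝟙 (tm ≫ tpu) ⊗≫ tm ◁ w₁.hom ⊗≫ un.hom ▷ tl ⊗≫ tuPP ◁ to₄.hom ⊗≫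
        𝟙 (tuPP ≫ tlP ≫ tpl ≫ tmT)) ▷ (l₁ ≫ pm) ⊗≫
      tuPP ◁ ((tlP ≫ tpl) ◁ o₄T.hom ▷ pm ⊗≫
        tlP ◁ ln.hom ▷ (pl₁ ≫ mTT ≫ pm) ⊗≫ (tlP ≫ lTP ≫ ptl ≫ pl₁) ◁ nm.inv ⊗≫
        (tlP ≫ lTP) ◁ po₃.hom ▷ μT ⊗≫ o₃P.hom ▷ (pl ≫ μT)) =
    𝟙 _ ⊗≫ tm ◁ nu.hom ▷ pm ⊗≫ (tm ≫ l) ◁ pb.inv ⊗≫ o₄.hom ⊗≫ bPP.hom ▷ (lP ≫ pl ≫ μT) ⊗≫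
      𝟙 _ := by
  calc
    _ = 𝟙 _ ⊗≫ tm ◁ w₁.hom ▷ (l₁ ≫ pm) ⊗≫ un.hom ▷ (tl ≫ l₁ ≫ pm) ⊗≫
        tuPP ◁ (𝟙 (ttm ≫ tl ≫ l₁ ≫ pm) ⊗≫ to₄.hom ▷ (l₁ ≫ pm) ⊗≫ (tlP ≫ tpl) ◁ o₄T.hom ▷ pm ⊗≫
        tlP ◁ ln.hom ▷ (pl₁ ≫ mTT ≫ pm) ⊗≫ (tlP ≫ lTP ≫ ptl ≫ pl₁) ◁ nm.inv ⊗≫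
        (tlP ≫ lTP) ◁ po₃.hom ▷ μT ⊗≫ o₃P.hom ▷ (pl ≫ μT) ⊗≫ 𝟙 (mPP ≫ lP ≫ pl ≫ μT)) ⊗≫
        𝟙 _ := by bicategory
    -- W5 replaces the long composite by one that starts with `ω₃`, which can slide back to meet
    -- `Tω₁`; W1 then applies.
    _ = 𝟙 _ ⊗≫ tm ◁ w₁.hom ▷ (l₁ ≫ pm) ⊗≫
        (un.hom ▷ (tl ≫ l₁ ≫ pm) ≫ (tuPP ≫ ttm) ◁ o₃.hom) ⊗≫
        tuPP ◁ mn.hom ▷ l ⊗≫ tuPP ◁ mPP ◁ o₄.hom ⊗≫ 𝟙 _ := by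
      rw [h₅]; bicategory
    _ = 𝟙 _ ⊗≫ tm ◁ (w₁.hom ▷ (l₁ ≫ pm) ⊗≫ tuP ◁ o₃.hom) ⊗≫ un.hom ▷ (mP ≫ l) ⊗≫
        tuPP ◁ mn.hom ▷ l ⊗≫ tuPP ◁ mPP ◁ o₄.hom ⊗≫ 𝟙 _ := by
      rw [← whisker_exchange]; bicategory
    _ = 𝟙 _ ⊗≫ tm ◁ nu.hom ▷ pm ⊗≫ tm ◁ l ◁ pb.inv ⊗≫
        (tm ◁ bP.hom ⊗≫ un.hom ▷ mP ⊗≫ tuPP ◁ mn.hom) ▷ l ⊗≫ tuPP ◁ mPP ◁ o₄.hom ⊗≫ 𝟙 _ := by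
      rw [h₁]; bicategory
    _ = 𝟙 _ ⊗≫ tm ◁ nu.hom ▷ pm ⊗≫ tm ◁ l ◁ pb.inv ⊗≫
        (bPP.hom ▷ (tm ≫ l) ≫ (tuPP ≫ mPP) ◁ o₄.hom) ⊗≫ 𝟙 _ := by
      rw [hb]; bicategory
    _ = _ := by
      rw [← whisker_exchange]; bicategory

/-- Evaluation of the other side of `W9`, whiskered by `T`, through the modification `ω₄`. -/
lemma mul_unit_pasting_right {a b c d k e₂ f₂ g₂ h₂ i₂ j₂ n q : C}
    {tm : a ⟶ k} {tpu : k ⟶ b} {l : k ⟶ d} {l₁ : b ⟶ c} {pm : c ⟶ d} {ptu : d ⟶ c}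
    {tuPP : a ⟶ e₂} {mPP : e₂ ⟶ a}
    {tlP : e₂ ⟶ f₂} {tpl : f₂ ⟶ g₂} {tmT : g₂ ⟶ b} {lPT : g₂ ⟶ h₂} {pl₁ : h₂ ⟶ i₂}
    {mTT : i₂ ⟶ c} {lTP : f₂ ⟶ j₂} {ptl : j₂ ⟶ h₂} {ppm : i₂ ⟶ n} {μT : n ⟶ d}
    {lP : a ⟶ q} {pl : q ⟶ n} {pmP : j₂ ⟶ q} {tppu : a ⟶ g₂} {tpuP : a ⟶ f₂} {ptuP : q ⟶ j₂}
    {ptpu : q ⟶ h₂} {pptu : n ⟶ i₂}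
    (nu : tpu ≫ l₁ ≅ l ≫ ptu) (pb : 𝟙 d ≅ ptu ≫ pm) (bPP : 𝟙 a ≅ tuPP ≫ mPP)
    (o₄ : tm ≫ l ≅ lP ≫ pl ≫ μT) (o₄T : tmT ≫ l₁ ≅ lPT ≫ pl₁ ≫ mTT)
    (ln : tpl ≫ lPT ≅ lTP ≫ ptl) (nm : ppm ≫ μT ≅ mTT ≫ pm)
    (po₃ : ptl ≫ pl₁ ≫ ppm ≅ pmP ≫ pl) (o₃P : tlP ≫ lTP ≫ pmP ≅ mPP ≫ lP)
    (tnu : tppu ≫ tmT ≅ tm ≫ tpu) (tpw : tppu ≅ tpuP ≫ tpl) (w₁P : tpuP ≅ tuPP ≫ tlP)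
    (nuP : tpuP ≫ lTP ≅ lP ≫ ptuP) (npu : tppu ≫ lPT ≅ lP ≫ ptpu) (ptw : ptpu ≅ ptuP ≫ ptl)
    (pnu : ptpu ≫ pl₁ ≅ pl ≫ pptu) (nTu : pptu ≫ mTT ≅ μT ≫ ptu) (ppb : 𝟙 n ≅ pptu ≫ ppm)
    (pbP : 𝟙 q ≅ ptuP ≫ pmP)
    (h₁ : w₁P.hom ▷ (lTP ≫ pmP) ⊗≫ tuPP ◁ o₃P.hom =
      𝟙 _ ⊗≫ nuP.hom ▷ pmP ⊗≫ lP ◁ pbP.inv ⊗≫ bPP.hom ▷ lP ⊗≫ 𝟙 _)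
    (hp₁ : ptw.hom ▷ (pl₁ ≫ ppm) ⊗≫ ptuP ◁ po₃.hom =
      𝟙 _ ⊗≫ pnu.hom ▷ ppm ⊗≫ pl ◁ ppb.inv ⊗≫ pbP.hom ▷ pl ⊗≫ 𝟙 _)
    (hN : tpw.hom ▷ lPT ⊗≫ tpuP ◁ ln.hom ⊗≫ nuP.hom ▷ ptl =
      𝟙 _ ⊗≫ npu.hom ⊗≫ lP ◁ ptw.hom ⊗≫ 𝟙 _)
    (h₄ : tppu ◁ o₄T.hom ⊗≫ npu.hom ▷ (pl₁ ≫ mTT) ⊗≫ lP ◁ pnu.hom ▷ mTT ⊗≫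
        (lP ≫ pl) ◁ nTu.hom =
      𝟙 _ ⊗≫ tnu.hom ▷ l₁ ⊗≫ tm ◁ nu.hom ⊗≫ o₄.hom ▷ ptu ⊗≫ 𝟙 _)
    (hB : nTu.inv ▷ pm ⊗≫ pptu ◁ nm.inv ⊗≫ ppb.inv ▷ μT =
      𝟙 _ ⊗≫ μT ◁ pb.inv ⊗≫ 𝟙 (𝟙 n ≫ μT)) :
    (𝟙 (tm ≫ tpu) ⊗≫ tnu.inv ⊗≫ tpw.hom ▷ tmT ⊗≫ w₁P.hom ▷ (tpl ≫ tmT) ⊗≫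
        𝟙 (tuPP ≫ tlP ≫ tpl ≫ tmT)) ▷ (l₁ ≫ pm) ⊗≫
      tuPP ◁ ((tlP ≫ tpl) ◁ o₄T.hom ▷ pm ⊗≫
        tlP ◁ ln.hom ▷ (pl₁ ≫ mTT ≫ pm) ⊗≫ (tlP ≫ lTP ≫ ptl ≫ pl₁) ◁ nm.inv ⊗≫
        (tlP ≫ lTP) ◁ po₃.hom ▷ μT ⊗≫ o₃P.hom ▷ (pl ≫ μT)) =
    𝟙 _ ⊗≫ tm ◁ nu.hom ▷ pm ⊗≫ (tm ≫ l) ◁ pb.inv ⊗≫ o₄.hom ⊗≫ bPP.hom ▷ (lP ≫ pl ≫ μT) ⊗≫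
      𝟙 _ := by
  calc
    _ = 𝟙 _ ⊗≫ tnu.inv ▷ (l₁ ≫ pm) ⊗≫ tpw.hom ▷ (tmT ≫ l₁ ≫ pm) ⊗≫
        (w₁P.hom ▷ (tpl ≫ (tmT ≫ l₁) ≫ pm) ≫ (tuPP ≫ tlP) ◁ (tpl ◁ o₄T.hom ▷ pm ⊗≫
          ln.hom ▷ (pl₁ ≫ mTT ≫ pm) ⊗≫ (lTP ≫ ptl ≫ pl₁) ◁ nm.inv ⊗≫
          lTP ◁ po₃.hom ▷ μT)) ⊗≫ tuPP ◁ o₃P.hom ▷ (pl ≫ μT) ⊗≫ 𝟙 _ := by bicategory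
    _ = 𝟙 _ ⊗≫ tnu.inv ▷ (l₁ ≫ pm) ⊗≫
        (tpw.hom ▷ ((tmT ≫ l₁) ≫ pm) ≫ (tpuP ≫ tpl) ◁ (o₄T.hom ▷ pm)) ⊗≫
        tpuP ◁ ln.hom ▷ (pl₁ ≫ mTT ≫ pm) ⊗≫ (tpuP ≫ lTP ≫ ptl ≫ pl₁) ◁ nm.inv ⊗≫
        (tpuP ≫ lTP) ◁ po₃.hom ▷ μT ⊗≫
        (w₁P.hom ▷ (lTP ≫ pmP) ⊗≫ tuPP ◁ o₃P.hom) ▷ (pl ≫ μT) ⊗≫ 𝟙 _ := by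
      rw [← whisker_exchange]; bicategory
    _ = 𝟙 _ ⊗≫ tnu.inv ▷ (l₁ ≫ pm) ⊗≫ tppu ◁ o₄T.hom ▷ pm ⊗≫ tpw.hom ▷ (lPT ≫ pl₁ ≫ mTT ≫ pm) ⊗≫
        tpuP ◁ ln.hom ▷ (pl₁ ≫ mTT ≫ pm) ⊗≫
        ((tpuP ≫ lTP) ◁ ((ptl ≫ pl₁) ◁ nm.inv ⊗≫ po₃.hom ▷ μT ⊗≫ 𝟙 (pmP ≫ pl ≫ μT)) ≫
          nuP.hom ▷ (pmP ≫ pl ≫ μT)) ⊗≫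
        lP ◁ pbP.inv ▷ (pl ≫ μT) ⊗≫ bPP.hom ▷ (lP ≫ pl ≫ μT) ⊗≫ 𝟙 _ := by
      rw [← whisker_exchange, h₁]; bicategory
    _ = 𝟙 _ ⊗≫ tnu.inv ▷ (l₁ ≫ pm) ⊗≫ tppu ◁ o₄T.hom ▷ pm ⊗≫
        (tpw.hom ▷ lPT ⊗≫ tpuP ◁ ln.hom ⊗≫ nuP.hom ▷ ptl) ▷ (pl₁ ≫ mTT ≫ pm) ⊗≫
        (lP ≫ ptuP) ◁ ((ptl ≫ pl₁) ◁ nm.inv ⊗≫ po₃.hom ▷ μT ⊗≫ 𝟙 (pmP ≫ pl ≫ μT)) ⊗≫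
        lP ◁ pbP.inv ▷ (pl ≫ μT) ⊗≫ bPP.hom ▷ (lP ≫ pl ≫ μT) ⊗≫ 𝟙 _ := by
      rw [whisker_exchange]; bicategory
    _ = 𝟙 _ ⊗≫ tnu.inv ▷ (l₁ ≫ pm) ⊗≫ tppu ◁ o₄T.hom ▷ pm ⊗≫ npu.hom ▷ (pl₁ ≫ mTT ≫ pm) ⊗≫
        lP ◁ (ptw.hom ▷ (pl₁ ≫ mTT ≫ pm) ≫ (ptuP ≫ ptl) ◁ (pl₁ ◁ nm.inv)) ⊗≫
        lP ◁ ptuP ◁ po₃.hom ▷ μT ⊗≫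
        lP ◁ pbP.inv ▷ (pl ≫ μT) ⊗≫ bPP.hom ▷ (lP ≫ pl ≫ μT) ⊗≫ 𝟙 _ := by
      rw [hN]; bicategory
    _ = 𝟙 _ ⊗≫ tnu.inv ▷ (l₁ ≫ pm) ⊗≫ tppu ◁ o₄T.hom ▷ pm ⊗≫ npu.hom ▷ (pl₁ ≫ mTT ≫ pm) ⊗≫
        lP ◁ ptpu ◁ pl₁ ◁ nm.inv ⊗≫ lP ◁ (ptw.hom ▷ (pl₁ ≫ ppm) ⊗≫ ptuP ◁ po₃.hom) ▷ μT ⊗≫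
        lP ◁ pbP.inv ▷ (pl ≫ μT) ⊗≫ bPP.hom ▷ (lP ≫ pl ≫ μT) ⊗≫ 𝟙 _ := by
      rw [← whisker_exchange]; bicategory
    _ = 𝟙 _ ⊗≫ tnu.inv ▷ (l₁ ≫ pm) ⊗≫ tppu ◁ o₄T.hom ▷ pm ⊗≫ npu.hom ▷ (pl₁ ≫ mTT ≫ pm) ⊗≫
        lP ◁ ((ptpu ≫ pl₁) ◁ nm.inv ≫ pnu.hom ▷ (ppm ≫ μT)) ⊗≫ lP ◁ pl ◁ ppb.inv ▷ μT ⊗≫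
        lP ◁ (pbP.hom ≫ pbP.inv) ▷ (pl ≫ μT) ⊗≫ bPP.hom ▷ (lP ≫ pl ≫ μT) ⊗≫ 𝟙 _ := by
      rw [hp₁]; bicategory
    -- The inserted naturality cell of `μ` at `Tu` completes one side of the modification axiom of
    -- `ω₄` at `u`, and its inverse completes one side of the naturality of `μ` at `β⁻¹`.
    _ = 𝟙 _ ⊗≫ tnu.inv ▷ (l₁ ≫ pm) ⊗≫ tppu ◁ o₄T.hom ▷ pm ⊗≫ npu.hom ▷ (pl₁ ≫ mTT ≫ pm) ⊗≫
        lP ◁ pnu.hom ▷ (mTT ≫ pm) ⊗≫ lP ◁ pl ◁ (nTu.hom ≫ nTu.inv) ▷ pm ⊗≫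
        lP ◁ pl ◁ pptu ◁ nm.inv ⊗≫ lP ◁ pl ◁ ppb.inv ▷ μT ⊗≫
        bPP.hom ▷ (lP ≫ pl ≫ μT) ⊗≫ 𝟙 _ := by
      rw [whisker_exchange, Iso.hom_inv_id, Iso.hom_inv_id]; bicategory
    _ = 𝟙 _ ⊗≫ tnu.inv ▷ (l₁ ≫ pm) ⊗≫ (tppu ◁ o₄T.hom ⊗≫ npu.hom ▷ (pl₁ ≫ mTT) ⊗≫
          lP ◁ pnu.hom ▷ mTT ⊗≫ (lP ≫ pl) ◁ nTu.hom) ▷ pm ⊗≫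
        lP ◁ pl ◁ (nTu.inv ▷ pm ⊗≫ pptu ◁ nm.inv ⊗≫ ppb.inv ▷ μT) ⊗≫
        bPP.hom ▷ (lP ≫ pl ≫ μT) ⊗≫ 𝟙 _ := by
      bicategory
    _ = 𝟙 _ ⊗≫ (tnu.inv ≫ tnu.hom) ▷ (l₁ ≫ pm) ⊗≫ tm ◁ nu.hom ▷ pm ⊗≫
        (o₄.hom ▷ (ptu ≫ pm) ≫ (lP ≫ pl ≫ μT) ◁ pb.inv) ⊗≫
        bPP.hom ▷ (lP ≫ pl ≫ μT) ⊗≫ 𝟙 _ := by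
      rw [h₄, hB]; bicategory
    _ = _ := by
      rw [← whisker_exchange, Iso.inv_hom_id]; bicategory

end Pasting

section MulUnit

variable {C : Type u} [Bicategory.{w, v} C]

/-- Moves an equation to a differently bracketed boundary; the two side conditions are pure
coherence and are left to `bicategory`. -/
lemma eq_of_coherence {a b : C} {f g f' g' : a ⟶ b} [BicategoricalCoherence f f']
    [BicategoricalCoherence g' g] {θ θ' : f' ⟶ g'} (h : θ = θ') {A B : f ⟶ g}
    (hA : A = 𝟙 f ⊗≫ θ ⊗≫ 𝟙 g) (hB : B = 𝟙 f ⊗≫ θ' ⊗≫ 𝟙 g) : A = B := by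
  rw [hA, hB, h]

lemma cancel_coherence {a b : C} {f g h k : a ⟶ b} [BicategoricalCoherence g h] {A B : f ⟶ g}
    {R : h ⟶ k} (hR : IsIso R) (e : A ⊗≫ R = B ⊗≫ R) : A = B := by
  simpa only [bicategoricalComp, ← Category.assoc, cancel_mono] using e

namespace PseudodistributiveLaw

variable {T P : Pseudomonad C} (D : PseudodistributiveLaw T P)

/-- The modification axiom of `ω₄` as an equation of pastings. -/
lemma ω₄_square {X Y : C} (f : X ⟶ Y) :
    T.F.map (P.F.map (P.F.map f)) ◁ (D.ω₄ Y).hom ⊗≫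
        (D.lamNat (P.F.map f)).hom ▷ (P.F.map (D.lam Y) ≫ P.m (T.F.obj Y)) ⊗≫
        D.lam (P.F.obj X) ◁ P.F.cell (D.lamNat f).hom ▷ P.m (T.F.obj Y) ⊗≫
        (D.lam (P.F.obj X) ≫ P.F.map (D.lam X)) ◁ (P.mNat (T.F.map f)).hom =
      𝟙 _ ⊗≫ T.F.cell (P.mNat f).hom ▷ D.lam Y ⊗≫ T.F.map (P.m X) ◁ (D.lamNat f).hom ⊗≫
        (D.ω₄ X).hom ▷ P.F.map (T.F.map f) ⊗≫ 𝟙 _ := by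
  have h := D.ω₄_modification f
  simp only [pasteSquare, Iso.trans_hom, Iso.symm_hom, whiskerLeftIso_hom,
    whiskerRightIso_hom, Pseudofunctor.mapSquare_hom, Category.assoc] at h
  exact eq_of_coherence h (by bicategory) (by bicategory)

theorem w9 : D.W9 := by
  intro X
  rw [Pseudofunctor.mapCell_refl_comp]
  apply D.eq_of_cell_whiskerRight_eq
  have key := mul_unit_pasting_left
    (T.F.cellIso (D.ω₁ X)) (D.ω₃ X) (D.lamNat (T.u X)) (P.F.cellIso (T.β X)) (T.β (P.F.obj X))
    (T.β (P.F.obj (P.F.obj X))) (T.F.cellIso (T.uNat (P.m X))) (T.mNat (P.m X)) (D.ω₄ X)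
    (T.F.cellIso (D.ω₄ X)) (D.ω₄ (T.F.obj X)) (D.lamNat (D.lam X)) (P.mNat (T.m X))
    (P.F.cellIso (D.ω₃ X)) (D.ω₃ (P.F.obj X)) (D.w1_solved X) (T.β_square (P.m X)) ?_
  · have key' := mul_unit_pasting_right
      (D.lamNat (T.u X)) (P.F.cellIso (T.β X)) (T.β (P.F.obj (P.F.obj X))) (D.ω₄ X)
      (D.ω₄ (T.F.obj X)) (D.lamNat (D.lam X)) (P.mNat (T.m X))
      (P.F.cellIso (D.ω₃ X)) (D.ω₃ (P.F.obj X)) (T.F.cellIso (P.mNat (T.u X)))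
      (T.F.cellIso (P.F.cellIso (D.ω₁ X))) (T.F.cellIso (D.ω₁ (P.F.obj X)))
      (D.lamNat (T.u (P.F.obj X))) (D.lamNat (P.F.map (T.u X)))
      (P.F.cellIso (T.F.cellIso (D.ω₁ X))) (P.F.cellIso (D.lamNat (T.u X)))
      (P.mNat (T.F.map (T.u X))) (P.F.cellIso (P.F.cellIso (T.β X)))
      (P.F.cellIso (T.β (P.F.obj X))) (D.w1_solved (P.F.obj X)) ?_ ?_ ?_ ?_
    -- Both sides of W9, under `T` and followed by the same invertible tail of W5, have one common
    -- value; the tail is then cancelled.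
    · have e := key.trans key'.symm
      refine Eq.trans ?_ ((cancel_coherence ?_ e).trans ?_)
      · congr 1
        simp [bicategoricalComp]
      · unfold bicategoricalComp
        infer_instance
      · congr 1
        simp [bicategoricalComp]
    · have := P.F.cell_congr (D.w1_solved X)
      simp [bicategoricalComp] at this
      simp [bicategoricalComp, this]
    · have := D.lamCell_naturality (D.ω₁ X).hom
      simp only [D.lamCell_comp, D.lamCell_atom, pasteAlong_hom] at this
      exact eq_of_coherence this (by bicategory) (by bicategory)
    · exact D.ω₄_square (T.u X)
    · have := P.mCell_naturality (T.β X).inv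
      rw [← Iso.eq_comp_inv, Category.assoc, ← Iso.inv_comp_eq] at this
      simp only [P.mCell_comp, P.mCell_atom, P.mCell_id, pasteAlong_inv, Iso.symm_inv,
        idSquare, Iso.trans_hom, Iso.symm_hom] at this
      exact eq_of_coherence this (by bicategory) (by bicategory)
  · have := D.w5 X
    simpa only [Pseudofunctor.mapCell_compThree_comp, Pseudofunctor.mapCell_comp_comp,
      Pseudofunctor.mapCell_comp_compThree, Pseudofunctor.cellIso_hom] using this

end PseudodistributiveLaw

end MulUnit

/-! ### W7, from W2 and W4. -/

section Pasting

variable {C : Type u} [Bicategory.{w, v} C]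

/-- The unit pasting of `W7` is natural. -/
lemma unit_pasting_natural {a q a' q' s t r s' t' r' : C}
    {lX : a ⟶ q} {lY : a' ⟶ q'} {tpf : a ⟶ a'} {ptf : q ⟶ q'}
    {tpηX : a ⟶ s} {tmX : s ⟶ a} {lPX : s ⟶ t} {plX : t ⟶ r} {μX : r ⟶ q} {ptηX : q ⟶ t}
    {pηTX : q ⟶ r}
    {tpηY : a' ⟶ s'} {tmY : s' ⟶ a'} {lPY : s' ⟶ t'} {plY : t' ⟶ r'} {μY : r' ⟶ q'}
    {ptηY : q' ⟶ t'} {pηTY : q' ⟶ r'}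
    {tppf : s ⟶ s'} {ptpf : t ⟶ t'} {pptf : r ⟶ r'}
    (N : tpf ≫ lY ≅ lX ≫ ptf) (tn : tpf ≫ tpηY ≅ tpηX ≫ tppf) (tmn : tppf ≫ tmY ≅ tmX ≫ tpf)
    (NP : tppf ≫ lPY ≅ lPX ≫ ptpf) (pN : ptpf ≫ plY ≅ plX ≫ pptf) (mT : pptf ≫ μY ≅ μX ≫ ptf)
    (ptn : ptf ≫ ptηY ≅ ptηX ≫ ptpf) (pnT : ptf ≫ pηTY ≅ pηTX ≫ pptf)
    (tbX : 𝟙 a ≅ tpηX ≫ tmX) (o₄X : tmX ≫ lX ≅ lPX ≫ plX ≫ μX) (nηX : tpηX ≫ lPX ≅ lX ≫ ptηX)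
    (po₂X : ptηX ≫ plX ≅ pηTX) (bX : 𝟙 q ≅ pηTX ≫ μX)
    (tbY : 𝟙 a' ≅ tpηY ≫ tmY) (o₄Y : tmY ≫ lY ≅ lPY ≫ plY ≫ μY)
    (nηY : tpηY ≫ lPY ≅ lY ≫ ptηY) (po₂Y : ptηY ≫ plY ≅ pηTY) (bY : 𝟙 q' ≅ pηTY ≫ μY)
    (tβ : tpf ◁ tbY.hom ⊗≫ tn.hom ▷ tmY ⊗≫ tpηX ◁ tmn.hom = 𝟙 _ ⊗≫ tbX.hom ▷ tpf ⊗≫ 𝟙 _)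
    (h₄ : tppf ◁ o₄Y.hom ⊗≫ NP.hom ▷ (plY ≫ μY) ⊗≫ lPX ◁ pN.hom ▷ μY ⊗≫ (lPX ≫ plX) ◁ mT.hom =
      𝟙 _ ⊗≫ tmn.hom ▷ lY ⊗≫ tmX ◁ N.hom ⊗≫ o₄X.hom ▷ ptf ⊗≫ 𝟙 _)
    (hN : tn.hom ▷ lPY ⊗≫ tpηX ◁ NP.hom ⊗≫ nηX.hom ▷ ptpf =
      𝟙 _ ⊗≫ tpf ◁ nηY.hom ⊗≫ N.hom ▷ ptηY ⊗≫ lX ◁ ptn.hom ⊗≫ 𝟙 _)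
    (h₂ : ptf ◁ po₂Y.hom ⊗≫ pnT.hom =
      𝟙 _ ⊗≫ ptn.hom ▷ plY ⊗≫ ptηX ◁ pN.hom ⊗≫ po₂X.hom ▷ pptf ⊗≫ 𝟙 _)
    (hb : ptf ◁ bY.hom ⊗≫ pnT.hom ▷ μY ⊗≫ pηTX ◁ mT.hom = 𝟙 _ ⊗≫ bX.hom ▷ ptf ⊗≫ 𝟙 _) :
    tpf ◁ (𝟙 lY ⊗≫ tbY.hom ▷ lY ⊗≫ tpηY ◁ o₄Y.hom ⊗≫ nηY.hom ▷ (plY ≫ μY) ⊗≫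
        lY ◁ po₂Y.hom ▷ μY ⊗≫ lY ◁ bY.inv ⊗≫ 𝟙 lY) ≫ N.hom =
      N.hom ≫ (𝟙 lX ⊗≫ tbX.hom ▷ lX ⊗≫ tpηX ◁ o₄X.hom ⊗≫ nηX.hom ▷ (plX ≫ μX) ⊗≫
        lX ◁ po₂X.hom ▷ μX ⊗≫ lX ◁ bX.inv ⊗≫ 𝟙 lX) ▷ ptf := by
  symm
  calc
    _ = 𝟙 _ ⊗≫ (𝟙 a ◁ N.hom ≫ tbX.hom ▷ (lX ≫ ptf)) ⊗≫ tpηX ◁ o₄X.hom ▷ ptf ⊗≫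
        nηX.hom ▷ (plX ≫ μX ≫ ptf) ⊗≫ lX ◁ po₂X.hom ▷ (μX ≫ ptf) ⊗≫ lX ◁ bX.inv ▷ ptf ⊗≫
        𝟙 _ := by bicategory
    _ = 𝟙 _ ⊗≫ (𝟙 (tpf ≫ 𝟙 a') ⊗≫ tbX.hom ▷ tpf ⊗≫ 𝟙 (tpηX ≫ tmX ≫ tpf)) ▷ lY ⊗≫
        (tpηX ≫ tmX) ◁ N.hom ⊗≫ tpηX ◁ o₄X.hom ▷ ptf ⊗≫
        nηX.hom ▷ (plX ≫ μX ≫ ptf) ⊗≫ lX ◁ po₂X.hom ▷ (μX ≫ ptf) ⊗≫ lX ◁ bX.inv ▷ ptf ⊗≫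
        𝟙 _ := by
      rw [whisker_exchange]; bicategory
    _ = 𝟙 _ ⊗≫ tpf ◁ tbY.hom ▷ lY ⊗≫ tn.hom ▷ (tmY ≫ lY) ⊗≫
        tpηX ◁ (𝟙 (tppf ≫ tmY ≫ lY) ⊗≫ tmn.hom ▷ lY ⊗≫ tmX ◁ N.hom ⊗≫ o₄X.hom ▷ ptf ⊗≫
          𝟙 ((lPX ≫ plX) ≫ μX ≫ ptf)) ⊗≫
        nηX.hom ▷ (plX ≫ μX ≫ ptf) ⊗≫ lX ◁ po₂X.hom ▷ (μX ≫ ptf) ⊗≫ lX ◁ bX.inv ▷ ptf ⊗≫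
        𝟙 _ := by
      rw [← tβ]; bicategory
    _ = 𝟙 _ ⊗≫ tpf ◁ tbY.hom ▷ lY ⊗≫ (tn.hom ▷ (tmY ≫ lY) ≫ (tpηX ≫ tppf) ◁ o₄Y.hom) ⊗≫
        tpηX ◁ NP.hom ▷ (plY ≫ μY) ⊗≫
        ((tpηX ≫ lPX) ◁ (pN.hom ▷ μY ⊗≫ plX ◁ mT.hom) ≫ nηX.hom ▷ (plX ≫ μX ≫ ptf)) ⊗≫
        lX ◁ po₂X.hom ▷ (μX ≫ ptf) ⊗≫ lX ◁ bX.inv ▷ ptf ⊗≫ 𝟙 _ := by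
      rw [← h₄]; bicategory
    _ = 𝟙 _ ⊗≫ tpf ◁ tbY.hom ▷ lY ⊗≫ tpf ◁ tpηY ◁ o₄Y.hom ⊗≫
        (tn.hom ▷ lPY ⊗≫ tpηX ◁ NP.hom ⊗≫ nηX.hom ▷ ptpf) ▷ (plY ≫ μY) ⊗≫
        lX ◁ ptηX ◁ pN.hom ▷ μY ⊗≫
        lX ◁ ((ptηX ≫ plX) ◁ mT.hom ≫ po₂X.hom ▷ (μX ≫ ptf)) ⊗≫ lX ◁ bX.inv ▷ ptf ⊗≫ 𝟙 _ := by
      rw [← whisker_exchange tn.hom, whisker_exchange nηX.hom]; bicategory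
    _ = 𝟙 _ ⊗≫ tpf ◁ tbY.hom ▷ lY ⊗≫ tpf ◁ tpηY ◁ o₄Y.hom ⊗≫
        tpf ◁ nηY.hom ▷ (plY ≫ μY) ⊗≫ N.hom ▷ (ptηY ≫ plY ≫ μY) ⊗≫
        lX ◁ (𝟙 (ptf ≫ ptηY ≫ plY) ⊗≫ ptn.hom ▷ plY ⊗≫ ptηX ◁ pN.hom ⊗≫ po₂X.hom ▷ pptf ⊗≫
          𝟙 (pηTX ≫ pptf)) ▷ μY ⊗≫
        lX ◁ pηTX ◁ mT.hom ⊗≫ lX ◁ bX.inv ▷ ptf ⊗≫ 𝟙 _ := by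
      rw [hN, whisker_exchange]; bicategory
    -- The pair `bY.inv ≫ bY.hom` is inserted so that its second factor starts one side of the
    -- modification axiom `hb`.
    _ = 𝟙 _ ⊗≫ tpf ◁ tbY.hom ▷ lY ⊗≫ tpf ◁ tpηY ◁ o₄Y.hom ⊗≫
        tpf ◁ nηY.hom ▷ (plY ≫ μY) ⊗≫ N.hom ▷ (ptηY ≫ plY ≫ μY) ⊗≫
        lX ◁ ptf ◁ po₂Y.hom ▷ μY ⊗≫ lX ◁ ptf ◁ (bY.inv ≫ bY.hom) ⊗≫ lX ◁ pnT.hom ▷ μY ⊗≫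
        lX ◁ pηTX ◁ mT.hom ⊗≫ lX ◁ bX.inv ▷ ptf ⊗≫ 𝟙 _ := by
      rw [← h₂, Iso.inv_hom_id]; bicategory
    _ = 𝟙 _ ⊗≫ tpf ◁ tbY.hom ▷ lY ⊗≫ tpf ◁ tpηY ◁ o₄Y.hom ⊗≫
        tpf ◁ nηY.hom ▷ (plY ≫ μY) ⊗≫ N.hom ▷ (ptηY ≫ plY ≫ μY) ⊗≫
        lX ◁ ptf ◁ po₂Y.hom ▷ μY ⊗≫ lX ◁ ptf ◁ bY.inv ⊗≫
        lX ◁ (ptf ◁ bY.hom ⊗≫ pnT.hom ▷ μY ⊗≫ pηTX ◁ mT.hom) ⊗≫ lX ◁ bX.inv ▷ ptf ⊗≫ 𝟙 _ := by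
      bicategory
    _ = 𝟙 _ ⊗≫ tpf ◁ tbY.hom ▷ lY ⊗≫ tpf ◁ tpηY ◁ o₄Y.hom ⊗≫ tpf ◁ nηY.hom ▷ (plY ≫ μY) ⊗≫
        (N.hom ▷ ((ptηY ≫ plY) ≫ μY) ≫ (lX ≫ ptf) ◁ (po₂Y.hom ▷ μY ≫ bY.inv)) ⊗≫
        lX ◁ (bX.hom ≫ bX.inv) ▷ ptf ⊗≫ 𝟙 _ := by
      rw [hb]; bicategory
    _ = _ := by
      rw [← whisker_exchange, Iso.hom_inv_id]; bicategory

/-- W2 solved for the part formed by `ω₄` and `ω₂`, by the invertibility of the other factors. -/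
lemma counit_pasting_of_eq_id {a b c e d : C} {l : a ⟶ b} {tη : a ⟶ c} {tm : c ⟶ a}
    {lP : c ⟶ d} {ηTP : a ⟶ d} {pl : d ⟶ e} {μT : e ⟶ b} {ηT : b ⟶ e}
    (ta : tη ≫ tm ≅ 𝟙 a) (o₄ : tm ≫ l ≅ lP ≫ pl ≫ μT) (o₂ : tη ≫ lP ≅ ηTP)
    (nl : l ≫ ηT ≅ ηTP ≫ pl) (aT : ηT ≫ μT ≅ 𝟙 b)
    (h : (𝟙 l ⊗≫ ta.inv ▷ l ⊗≫ tη ◁ o₄.hom ⊗≫ o₂.hom ▷ (pl ≫ μT) ⊗≫ nl.inv ▷ μT ⊗≫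
      l ◁ aT.hom ⊗≫ 𝟙 l) = 𝟙 l) :
    tη ◁ o₄.hom ⊗≫ o₂.hom ▷ (pl ≫ μT) =
      𝟙 _ ⊗≫ ta.hom ▷ l ⊗≫ l ◁ aT.inv ⊗≫ nl.hom ▷ μT ⊗≫ 𝟙 _ := by
  calc
    _ = 𝟙 _ ⊗≫ (ta.hom ≫ ta.inv) ▷ l ⊗≫ tη ◁ o₄.hom ⊗≫ o₂.hom ▷ (pl ≫ μT) ⊗≫
        (nl.inv ≫ nl.hom) ▷ μT ⊗≫ 𝟙 _ := by
      rw [Iso.hom_inv_id, Iso.inv_hom_id]; bicategory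
    _ = 𝟙 _ ⊗≫ ta.hom ▷ l ⊗≫ ta.inv ▷ l ⊗≫ tη ◁ o₄.hom ⊗≫ o₂.hom ▷ (pl ≫ μT) ⊗≫
        nl.inv ▷ μT ⊗≫ l ◁ (aT.hom ≫ aT.inv) ⊗≫ nl.hom ▷ μT ⊗≫ 𝟙 _ := by
      rw [Iso.hom_inv_id aT]; bicategory
    _ = 𝟙 _ ⊗≫ ta.hom ▷ l ⊗≫ (𝟙 l ⊗≫ ta.inv ▷ l ⊗≫ tη ◁ o₄.hom ⊗≫ o₂.hom ▷ (pl ≫ μT) ⊗≫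
        nl.inv ▷ μT ⊗≫ l ◁ aT.hom ⊗≫ 𝟙 l) ⊗≫ l ◁ aT.inv ⊗≫ nl.hom ▷ μT ⊗≫ 𝟙 _ := by
      bicategory
    _ = _ := by
      rw [h]; bicategory

/-- The unit pasting of `W7` at `P X`, whiskered by `Pλ ≫ μT`, is trivial. -/
lemma right_unit_pasting {a s k d t q n r o : C}
    {tpηP : a ⟶ s} {tpm tmP : s ⟶ a} {tm : a ⟶ k} {l : k ⟶ d} {lPP : s ⟶ t} {lP : a ⟶ q}
    {pl : q ⟶ n} {μT : n ⟶ d} {plP : t ⟶ r} {μTP : r ⟶ q} {ppl : r ⟶ o} {μPT pmT : o ⟶ n}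
    {ptm : t ⟶ q} {ptηP : q ⟶ t} {pηTP : q ⟶ r} {pηPT : n ⟶ o}
    (tγ : tpm ≫ tm ≅ tmP ≫ tm) (o₄ : tm ≫ l ≅ lP ≫ pl ≫ μT)
    (o₄P : tmP ≫ lP ≅ lPP ≫ plP ≫ μTP) (ml : ppl ≫ μPT ≅ μTP ≫ pl)
    (nμ : tpm ≫ lP ≅ lPP ≫ ptm) (po₄ : ptm ≫ pl ≅ plP ≫ ppl ≫ pmT)
    (γT : pmT ≫ μT ≅ μPT ≫ μT) (nη : tpηP ≫ lPP ≅ lP ≫ ptηP) (po₂P : ptηP ≫ plP ≅ pηTP)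
    (bTP : 𝟙 q ≅ pηTP ≫ μTP) (tbP : 𝟙 a ≅ tpηP ≫ tmP) (tpa : tpηP ≫ tpm ≅ 𝟙 a)
    (pta : ptηP ≫ ptm ≅ 𝟙 q) (paT : pηPT ≫ pmT ≅ 𝟙 n) (bPT : 𝟙 n ≅ pηPT ≫ μPT)
    (pnl : pl ≫ pηPT ≅ pηTP ≫ ppl)
    (h₄ : (𝟙 (tpm ≫ tm ≫ l) ⊗≫ tγ.hom ▷ l ⊗≫ tmP ◁ o₄.hom ⊗≫ o₄P.hom ▷ (pl ≫ μT) ⊗≫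
        (lPP ≫ plP) ◁ ml.inv ▷ μT ⊗≫ 𝟙 (lPP ≫ plP ≫ ppl ≫ μPT ≫ μT)) =
      𝟙 _ ⊗≫ tpm ◁ o₄.hom ⊗≫ nμ.hom ▷ (pl ≫ μT) ⊗≫ lPP ◁ po₄.hom ▷ μT ⊗≫
        (lPP ≫ plP ≫ ppl) ◁ γT.hom ⊗≫ 𝟙 _)
    (htu : tpηP ◁ tγ.hom = 𝟙 _ ⊗≫ tpa.hom ▷ tm ⊗≫ tbP.hom ▷ tm ⊗≫ 𝟙 _)
    (hu : pηPT ◁ γT.hom = 𝟙 _ ⊗≫ paT.hom ▷ μT ⊗≫ bPT.hom ▷ μT ⊗≫ 𝟙 _)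
    (hN : tpηP ◁ nμ.hom ⊗≫ nη.hom ▷ ptm ⊗≫ lP ◁ pta.hom =
      𝟙 _ ⊗≫ tpa.hom ▷ lP ⊗≫ 𝟙 (lP ≫ 𝟙 q))
    (hp₂ : ptηP ◁ po₄.hom ⊗≫ po₂P.hom ▷ (ppl ≫ pmT) =
      𝟙 _ ⊗≫ pta.hom ▷ pl ⊗≫ pl ◁ paT.inv ⊗≫ pnl.hom ▷ pmT ⊗≫ 𝟙 _)
    (hb : pl ◁ bPT.hom ⊗≫ pnl.hom ▷ μPT ⊗≫ pηTP ◁ ml.hom = 𝟙 _ ⊗≫ bTP.hom ▷ pl ⊗≫ 𝟙 _) :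
    (𝟙 lP ⊗≫ tbP.hom ▷ lP ⊗≫ tpηP ◁ o₄P.hom ⊗≫ nη.hom ▷ (plP ≫ μTP) ⊗≫
      lP ◁ po₂P.hom ▷ μTP ⊗≫ lP ◁ bTP.inv ⊗≫ 𝟙 lP) ▷ (pl ≫ μT) = 𝟙 _ := by
  -- Precomposing with `TPα^P` lets it meet `Tβ^P`, so that the `T`-image of the unit axiom of `P`
  -- yields `Tγ^P`; `ω₄` is the other cell that W4 needs.
  rw [← cancel_epi (tpa.hom ▷ (tm ≫ l) ≫ (λ_ _).hom ≫ o₄.hom)]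
  calc
    _ = 𝟙 _ ⊗≫ tpa.hom ▷ (tm ≫ l) ⊗≫ (𝟙 a ◁ o₄.hom ≫ tbP.hom ▷ (lP ≫ pl ≫ μT)) ⊗≫
        tpηP ◁ o₄P.hom ▷ (pl ≫ μT) ⊗≫ nη.hom ▷ (plP ≫ μTP ≫ pl ≫ μT) ⊗≫
        lP ◁ po₂P.hom ▷ (μTP ≫ pl ≫ μT) ⊗≫ lP ◁ bTP.inv ▷ (pl ≫ μT) ⊗≫ 𝟙 _ := by bicategory
    -- The first composite of W4 ends with the inverse of the naturality cell of `μ` at `λ`, hence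
    -- the inserted pair.
    _ = 𝟙 _ ⊗≫ (𝟙 (tpηP ≫ tpm ≫ tm) ⊗≫ tpa.hom ▷ tm ⊗≫ tbP.hom ▷ tm ⊗≫
          𝟙 (tpηP ≫ tmP ≫ tm)) ▷ l ⊗≫ (tpηP ≫ tmP) ◁ o₄.hom ⊗≫
        tpηP ◁ o₄P.hom ▷ (pl ≫ μT) ⊗≫ tpηP ◁ (lPP ≫ plP) ◁ (ml.inv ≫ ml.hom) ▷ μT ⊗≫
        nη.hom ▷ (plP ≫ μTP ≫ pl ≫ μT) ⊗≫
        lP ◁ po₂P.hom ▷ (μTP ≫ pl ≫ μT) ⊗≫ lP ◁ bTP.inv ▷ (pl ≫ μT) ⊗≫ 𝟙 _ := by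
      rw [whisker_exchange, Iso.inv_hom_id]; bicategory
    _ = 𝟙 _ ⊗≫ tpηP ◁ (𝟙 (tpm ≫ tm ≫ l) ⊗≫ tγ.hom ▷ l ⊗≫ tmP ◁ o₄.hom ⊗≫
          o₄P.hom ▷ (pl ≫ μT) ⊗≫ (lPP ≫ plP) ◁ ml.inv ▷ μT ⊗≫
          𝟙 (lPP ≫ plP ≫ ppl ≫ μPT ≫ μT)) ⊗≫
        tpηP ◁ (lPP ≫ plP) ◁ ml.hom ▷ μT ⊗≫ nη.hom ▷ (plP ≫ μTP ≫ pl ≫ μT) ⊗≫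
        lP ◁ po₂P.hom ▷ (μTP ≫ pl ≫ μT) ⊗≫ lP ◁ bTP.inv ▷ (pl ≫ μT) ⊗≫ 𝟙 _ := by
      rw [← htu]; bicategory
    _ = 𝟙 _ ⊗≫ (tpηP ≫ tpm) ◁ o₄.hom ⊗≫ tpηP ◁ nμ.hom ▷ (pl ≫ μT) ⊗≫
        ((tpηP ≫ lPP) ◁ (po₄.hom ▷ μT ⊗≫ (plP ≫ ppl) ◁ γT.hom ⊗≫ plP ◁ ml.hom ▷ μT ⊗≫
          𝟙 (plP ≫ μTP ≫ pl ≫ μT)) ≫ nη.hom ▷ (plP ≫ μTP ≫ pl ≫ μT)) ⊗≫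
        lP ◁ po₂P.hom ▷ (μTP ≫ pl ≫ μT) ⊗≫ lP ◁ bTP.inv ▷ (pl ≫ μT) ⊗≫ 𝟙 _ := by
      rw [h₄]; bicategory
    _ = 𝟙 _ ⊗≫ (tpηP ≫ tpm) ◁ o₄.hom ⊗≫ tpηP ◁ nμ.hom ▷ (pl ≫ μT) ⊗≫
        nη.hom ▷ (ptm ≫ pl ≫ μT) ⊗≫ lP ◁ (pta.hom ≫ pta.inv) ▷ (pl ≫ μT) ⊗≫
        lP ◁ ptηP ◁ po₄.hom ▷ μT ⊗≫
        lP ◁ ((ptηP ≫ plP) ◁ (ppl ◁ γT.hom ⊗≫ ml.hom ▷ μT ⊗≫ 𝟙 (μTP ≫ pl ≫ μT)) ≫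
          po₂P.hom ▷ (μTP ≫ pl ≫ μT)) ⊗≫ lP ◁ bTP.inv ▷ (pl ≫ μT) ⊗≫ 𝟙 _ := by
      rw [whisker_exchange, Iso.hom_inv_id]; bicategory
    _ = 𝟙 _ ⊗≫ (tpηP ≫ tpm) ◁ o₄.hom ⊗≫
        (tpηP ◁ nμ.hom ⊗≫ nη.hom ▷ ptm ⊗≫ lP ◁ pta.hom) ▷ (pl ≫ μT) ⊗≫
        lP ◁ pta.inv ▷ (pl ≫ μT) ⊗≫
        lP ◁ (ptηP ◁ po₄.hom ⊗≫ po₂P.hom ▷ (ppl ≫ pmT)) ▷ μT ⊗≫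
        lP ◁ pηTP ◁ ppl ◁ γT.hom ⊗≫ lP ◁ pηTP ◁ ml.hom ▷ μT ⊗≫
        lP ◁ bTP.inv ▷ (pl ≫ μT) ⊗≫ 𝟙 _ := by
      rw [whisker_exchange]; bicategory
    _ = 𝟙 _ ⊗≫ (tpηP ≫ tpm) ◁ o₄.hom ⊗≫ tpa.hom ▷ (lP ≫ pl ≫ μT) ⊗≫
        lP ◁ (pta.inv ≫ pta.hom) ▷ (pl ≫ μT) ⊗≫ lP ◁ pl ◁ paT.inv ▷ μT ⊗≫
        lP ◁ (pnl.hom ▷ (pmT ≫ μT) ≫ (pηTP ≫ ppl) ◁ γT.hom) ⊗≫ lP ◁ pηTP ◁ ml.hom ▷ μT ⊗≫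
        lP ◁ bTP.inv ▷ (pl ≫ μT) ⊗≫ 𝟙 _ := by
      rw [hN, hp₂]; bicategory
    _ = 𝟙 _ ⊗≫ (tpηP ≫ tpm) ◁ o₄.hom ⊗≫ tpa.hom ▷ (lP ≫ pl ≫ μT) ⊗≫
        lP ◁ pl ◁ paT.inv ▷ μT ⊗≫ lP ◁ pl ◁ (pηPT ◁ γT.hom) ⊗≫ lP ◁ pnl.hom ▷ (μPT ≫ μT) ⊗≫
        lP ◁ pηTP ◁ ml.hom ▷ μT ⊗≫ lP ◁ bTP.inv ▷ (pl ≫ μT) ⊗≫ 𝟙 _ := by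
      rw [← whisker_exchange, Iso.inv_hom_id]; bicategory
    _ = 𝟙 _ ⊗≫ (tpηP ≫ tpm) ◁ o₄.hom ⊗≫ tpa.hom ▷ (lP ≫ pl ≫ μT) ⊗≫
        lP ◁ pl ◁ (paT.inv ≫ paT.hom) ▷ μT ⊗≫
        lP ◁ (pl ◁ bPT.hom ⊗≫ pnl.hom ▷ μPT ⊗≫ pηTP ◁ ml.hom) ▷ μT ⊗≫
        lP ◁ bTP.inv ▷ (pl ≫ μT) ⊗≫ 𝟙 _ := by
      rw [hu]; bicategory
    _ = 𝟙 _ ⊗≫ ((tpηP ≫ tpm) ◁ o₄.hom ≫ tpa.hom ▷ (lP ≫ pl ≫ μT)) ⊗≫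
        lP ◁ (bTP.hom ≫ bTP.inv) ▷ (pl ≫ μT) ⊗≫ 𝟙 _ := by
      rw [hb, Iso.inv_hom_id]; bicategory
    _ = _ := by
      rw [whisker_exchange, Iso.hom_inv_id]; bicategory

end Pasting

section RightUnit

variable {C : Type u} [Bicategory.{w, v} C]

/-- The square `hN` turns `K ▷ g` into a whiskering of `K'`, which becomes trivial after `r`; and
`K` is recovered from `K ▷ (g ≫ r)` because `g ≫ r` is isomorphic to an identity. -/
lemma eq_id_of_whiskerRight_of_natural {a q a' q' : C} {l : a ⟶ q} {l' : a' ⟶ q'} {f : a ⟶ a'}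
    {g : q ⟶ q'} {r : q' ⟶ q} (i : g ≫ r ≅ 𝟙 q) (N : f ≫ l' ≅ l ≫ g) {K : l ⟶ l} {K' : l' ⟶ l'}
    (hN : f ◁ K' ≫ N.hom = N.hom ≫ K ▷ g) (h : K' ▷ r = 𝟙 _) : K = 𝟙 l := by
  have e : K ▷ (g ≫ r) = 𝟙 _ := by
    calc
      _ = 𝟙 _ ⊗≫ (N.inv ≫ N.hom ≫ K ▷ g) ▷ r ⊗≫ 𝟙 _ := by
        rw [Iso.inv_hom_id_assoc]; bicategory
      _ = 𝟙 _ ⊗≫ N.inv ▷ r ⊗≫ f ◁ (K' ▷ r) ⊗≫ N.hom ▷ r ⊗≫ 𝟙 _ := by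
        rw [← hN]; bicategory
      _ = 𝟙 _ ⊗≫ (N.inv ≫ N.hom) ▷ r ⊗≫ 𝟙 _ := by
        rw [h]; bicategory
      _ = _ := by
        rw [Iso.inv_hom_id]; bicategory
  calc
    _ = 𝟙 _ ⊗≫ (K ▷ 𝟙 q ≫ l ◁ i.inv) ⊗≫ l ◁ i.hom ⊗≫ 𝟙 _ := by
      rw [← cancel_mono (ρ_ l).inv]
      simp [bicategoricalComp]
    _ = 𝟙 _ ⊗≫ l ◁ i.inv ⊗≫ K ▷ (g ≫ r) ⊗≫ l ◁ i.hom ⊗≫ 𝟙 _ := by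
      rw [← whisker_exchange]; bicategory
    _ = 𝟙 _ ⊗≫ l ◁ (i.inv ≫ i.hom) ⊗≫ 𝟙 _ := by
      rw [e]; bicategory
    _ = _ := by
      rw [Iso.inv_hom_id]; bicategory

namespace PseudodistributiveLaw

variable {T P : Pseudomonad C} (D : PseudodistributiveLaw T P)

/-- The modification axiom of `ω₂` as an equation of pastings. -/
lemma ω₂_square {X Y : C} (f : X ⟶ Y) :
    T.F.map f ◁ (D.ω₂ Y).hom ⊗≫ (P.uNat (T.F.map f)).hom =
      𝟙 _ ⊗≫ T.F.cell (P.uNat f).hom ▷ D.lam Y ⊗≫ T.F.map (P.u X) ◁ (D.lamNat f).hom ⊗≫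
        (D.ω₂ X).hom ▷ P.F.map (T.F.map f) ⊗≫ 𝟙 _ := by
  have h := D.ω₂_modification f
  simp only [pasteSquare, Iso.trans_hom, Iso.symm_hom, whiskerLeftIso_hom,
    whiskerRightIso_hom, Pseudofunctor.mapSquare_hom, Category.assoc] at h
  exact eq_of_coherence h (by bicategory) (by bicategory)

/-- A solved form of `W2`. -/
lemma w2_solved (X : C) :
    T.F.map (P.u (P.F.obj X)) ◁ (D.ω₄ X).hom ⊗≫
        (D.ω₂ (P.F.obj X)).hom ▷ (P.F.map (D.lam X) ≫ P.m (T.F.obj X)) =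
      𝟙 _ ⊗≫ T.F.cell (P.α X).hom ▷ D.lam X ⊗≫ D.lam X ◁ (P.α (T.F.obj X)).inv ⊗≫
        (P.uNat (D.lam X)).hom ▷ P.m (T.F.obj X) ⊗≫ 𝟙 _ := by
  have h := D.w2 X
  rw [Pseudofunctor.mapCell_id_comp] at h
  exact counit_pasting_of_eq_id (T.F.cellIso (P.α X)) (D.ω₄ X) (D.ω₂ (P.F.obj X))
    (P.uNat (D.lam X)) (P.α (T.F.obj X)) h

theorem w7 : D.W7 := by
  intro X
  rw [Pseudofunctor.mapCell_id_comp, Pseudofunctor.mapCell_comp_refl]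
  -- Take `K` and `K'` to be the loops of W7 at `X` and at `PX`, linked by `η`. The retraction
  -- consists of `Pλ` and `μT`: preceded by `PTη`, it is isomorphic to the identity by `Pω₂` and
  -- `β^P`.
  refine eq_id_of_whiskerRight_of_natural
    ((α_ _ _ _).symm ≪≫ whiskerRightIso (P.F.cellIso (D.ω₂ X)) _ ≪≫ (P.β (T.F.obj X)).symm)
    (D.lamNat (P.u X))
    (unit_pasting_natural (D.lamNat (P.u X)) (T.F.cellIso (P.F.cellIso (P.uNat (P.u X))))
      (T.F.cellIso (P.mNat (P.u X))) (D.lamNat (P.F.map (P.u X)))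
      (P.F.cellIso (D.lamNat (P.u X))) (P.mNat (T.F.map (P.u X)))
      (P.F.cellIso (T.F.cellIso (P.uNat (P.u X)))) (P.F.cellIso (P.uNat (T.F.map (P.u X))))
      (T.F.cellIso (P.β X)) (D.ω₄ X) (D.lamNat (P.u X)) (P.F.cellIso (D.ω₂ X))
      (P.β (T.F.obj X)) (T.F.cellIso (P.β (P.F.obj X))) (D.ω₄ (P.F.obj X))
      (D.lamNat (P.u (P.F.obj X))) (P.F.cellIso (D.ω₂ (P.F.obj X)))
      (P.β (T.F.obj (P.F.obj X))) ?_ (D.ω₄_square (P.u X)) ?_ ?_ (P.β_square (T.F.map (P.u X))))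
    (right_unit_pasting (T.F.cellIso (P.γ X)) (D.ω₄ X) (D.ω₄ (P.F.obj X)) (P.mNat (D.lam X))
      (D.lamNat (P.m X)) (P.F.cellIso (D.ω₄ X)) (P.γ (T.F.obj X)) (D.lamNat (P.u (P.F.obj X)))
      (P.F.cellIso (D.ω₂ (P.F.obj X))) (P.β (T.F.obj (P.F.obj X)))
      (T.F.cellIso (P.β (P.F.obj X))) (T.F.cellIso (P.F.cellIso (P.α X)))
      (P.F.cellIso (T.F.cellIso (P.α X))) (P.F.cellIso (P.α (T.F.obj X)))
      (P.β (P.F.obj (T.F.obj X))) (P.F.cellIso (P.uNat (D.lam X))) ?_ ?_ ?_ ?_ ?_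
      (P.β_square (D.lam X)))
  · have := T.F.cell_congr (P.β_square (P.u X))
    simp [bicategoricalComp] at this
    simp [bicategoricalComp, this]
  · have := D.lamCell_naturality (P.uNat (P.u X)).hom
    simp only [D.lamCell_comp, D.lamCell_atom, pasteAlong_hom] at this
    exact eq_of_coherence this (by bicategory) (by bicategory)
  · have := P.F.cell_congr (D.ω₂_square (P.u X))
    simp [bicategoricalComp] at this
    simp [bicategoricalComp, this]
  · have := D.w4 X
    simpa only [Pseudofunctor.mapCell_compThree_comp, Pseudofunctor.mapCell_comp_comp,
      Pseudofunctor.mapCell_comp_compThree, Pseudofunctor.cellIso_hom] using this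
  · have := T.F.cell_congr (Pseudomonad.unit_axiom P X)
    simp only [Pseudofunctor.mapCell_comp_id] at this
    simp [bicategoricalComp] at this
    simp [bicategoricalComp, this]
  · have := Pseudomonad.unit_axiom P (T.F.obj X)
    simpa only [Pseudofunctor.mapCell_comp_id, Pseudofunctor.cellIso_hom] using this
  · have := D.lamCell_naturality (P.α X).hom
    simp only [D.lamCell_comp, D.lamCell_atom, D.lamCell_id, pasteAlong_hom, idSquare,
      Iso.symm_hom, Iso.trans_inv, Iso.symm_inv] at this
    exact eq_of_coherence this.symm (by bicategory) (by bicategory)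
  · have := P.F.cell_congr (D.w2_solved X)
    simp [bicategoricalComp] at this
    simp [bicategoricalComp, this]

end PseudodistributiveLaw

end RightUnit

/-! ### W8, from W5 and W7. -/

section Pasting

variable {C : Type u} [Bicategory.{w, v} C]

/-- The comparison of the two sides of `W8` becomes trivial after applying `P`. -/
lemma mul_counit_pasting_eq {s a b c d f g h i j n a' q k : C}
    {ttpη : s ⟶ a} {ttm : a ⟶ s} {tl : s ⟶ b} {l₁ : b ⟶ c} {pm : c ⟶ d} {tlP : a ⟶ f}
    {tpl : f ⟶ g} {tmT : g ⟶ b} {lPT : g ⟶ h} {pl₁ : h ⟶ i} {mTT : i ⟶ c} {lTP : f ⟶ j}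
    {ptl : j ⟶ h} {ppm : i ⟶ n} {μT : n ⟶ d} {mPP : a ⟶ a'} {lP : a' ⟶ q} {pl : q ⟶ n}
    {pmP : j ⟶ q} {mP : s ⟶ k} {tm : a' ⟶ k} {l : k ⟶ d} {tpη : k ⟶ a'} {ptη : d ⟶ q}
    {pηT : d ⟶ n} {pηTT : c ⟶ i} {tpηT : b ⟶ g} {ptηT : c ⟶ h} {tptη : b ⟶ f} {pttη : c ⟶ j}
    (to₄ : ttm ≫ tl ≅ tlP ≫ tpl ≫ tmT) (o₄T : tmT ≫ l₁ ≅ lPT ≫ pl₁ ≫ mTT)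
    (ln : tpl ≫ lPT ≅ lTP ≫ ptl) (nm : ppm ≫ μT ≅ mTT ≫ pm)
    (po₃ : ptl ≫ pl₁ ≫ ppm ≅ pmP ≫ pl) (o₃P : tlP ≫ lTP ≫ pmP ≅ mPP ≫ lP)
    (o₃ : tl ≫ l₁ ≫ pm ≅ mP ≫ l) (mn : ttm ≫ mP ≅ mPP ≫ tm) (o₄ : tm ≫ l ≅ lP ≫ pl ≫ μT)
    (tbη : 𝟙 k ≅ tpη ≫ tm) (ttb : 𝟙 s ≅ ttpη ≫ ttm) (bT : 𝟙 d ≅ pηT ≫ μT)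
    (bTT : 𝟙 c ≅ pηTT ≫ mTT) (tbT : 𝟙 b ≅ tpηT ≫ tmT) (po₂ : ptη ≫ pl ≅ pηT)
    (po₂T : ptηT ≫ pl₁ ≅ pηTT) (tpo₂ : tptη ≫ tpl ≅ tpηT) (pto₂ : pttη ≫ ptl ≅ ptηT)
    (nη : tpη ≫ lP ≅ l ≫ ptη) (nηT : tpηT ≫ lPT ≅ l₁ ≫ ptηT) (nTη : tptη ≫ lTP ≅ l₁ ≫ pttη)
    (tnη : ttpη ≫ tlP ≅ tl ≫ tptη) (mnη : ttpη ≫ mPP ≅ mP ≫ tpη) (pmn : pttη ≫ pmP ≅ pm ≫ ptη)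
    (pnm : pm ≫ pηT ≅ pηTT ≫ ppm)
    (h₅ : (𝟙 (ttm ≫ tl ≫ l₁ ≫ pm) ⊗≫ to₄.hom ▷ (l₁ ≫ pm) ⊗≫ (tlP ≫ tpl) ◁ o₄T.hom ▷ pm ⊗≫
        tlP ◁ ln.hom ▷ (pl₁ ≫ mTT ≫ pm) ⊗≫ (tlP ≫ lTP ≫ ptl ≫ pl₁) ◁ nm.inv ⊗≫
        (tlP ≫ lTP) ◁ po₃.hom ▷ μT ⊗≫ o₃P.hom ▷ (pl ≫ μT) ⊗≫ 𝟙 (mPP ≫ lP ≫ pl ≫ μT)) =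
      𝟙 _ ⊗≫ ttm ◁ o₃.hom ⊗≫ mn.hom ▷ l ⊗≫ mPP ◁ o₄.hom ⊗≫ 𝟙 _)
    (h₇ : tpη ◁ o₄.hom ⊗≫ nη.hom ▷ (pl ≫ μT) ⊗≫ l ◁ po₂.hom ▷ μT =
      𝟙 _ ⊗≫ tbη.inv ▷ l ⊗≫ l ◁ bT.hom ⊗≫ 𝟙 _)
    (h₇T : tpηT ◁ o₄T.hom ⊗≫ nηT.hom ▷ (pl₁ ≫ mTT) ⊗≫ l₁ ◁ po₂T.hom ▷ mTT =
      𝟙 _ ⊗≫ tbT.inv ▷ l₁ ⊗≫ l₁ ◁ bTT.hom ⊗≫ 𝟙 _)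
    (th₇ : ttpη ◁ to₄.hom ⊗≫ tnη.hom ▷ (tpl ≫ tmT) ⊗≫ tl ◁ tpo₂.hom ▷ tmT =
      𝟙 _ ⊗≫ ttb.inv ▷ tl ⊗≫ tl ◁ tbT.hom ⊗≫ 𝟙 _)
    (hN : tpo₂.hom ▷ lPT ⊗≫ nηT.hom =
      𝟙 _ ⊗≫ tptη ◁ ln.hom ⊗≫ nTη.hom ▷ ptl ⊗≫ l₁ ◁ pto₂.hom ⊗≫ 𝟙 _)
    (h₃ : ttpη ◁ o₃P.hom ⊗≫ mnη.hom ▷ lP ⊗≫ mP ◁ nη.hom =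
      𝟙 _ ⊗≫ tnη.hom ▷ (lTP ≫ pmP) ⊗≫ tl ◁ nTη.hom ▷ pmP ⊗≫ (tl ≫ l₁) ◁ pmn.hom ⊗≫
        o₃.hom ▷ ptη ⊗≫ 𝟙 _)
    (hM : ttpη ◁ mn.hom ⊗≫ mnη.hom ▷ tm = 𝟙 _ ⊗≫ ttb.inv ▷ mP ⊗≫ mP ◁ tbη.hom ⊗≫ 𝟙 _)
    (hb : pm ◁ bT.hom ⊗≫ pnm.hom ▷ μT ⊗≫ pηTT ◁ nm.hom = 𝟙 _ ⊗≫ bTT.hom ▷ pm ⊗≫ 𝟙 _) :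
    (tl ≫ l₁) ◁ ((𝟙 (pm ≫ pηT) ⊗≫ pnm.hom ⊗≫ po₂T.inv ▷ ppm ⊗≫ pto₂.inv ▷ (pl₁ ≫ ppm) ⊗≫
      pttη ◁ po₃.hom ⊗≫ pmn.hom ▷ pl ⊗≫ pm ◁ po₂.hom ⊗≫ 𝟙 (pm ≫ pηT)) ▷ μT) = 𝟙 _ := by
  have hL : IsIso (𝟙 ((ttpη ≫ ttm) ≫ tl ≫ l₁ ≫ pm) ⊗≫ ttb.inv ▷ (tl ≫ l₁ ≫ pm) ⊗≫
      (tl ≫ l₁ ≫ pm) ◁ bT.hom ⊗≫ 𝟙 ((tl ≫ l₁) ≫ (pm ≫ pηT) ≫ μT)) := by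
    unfold bicategoricalComp
    infer_instance
  have hR : IsIso (𝟙 ((tl ≫ l₁) ≫ (pm ≫ pηT) ≫ μT) ⊗≫ o₃.hom ▷ (pηT ≫ μT)) := by
    unfold bicategoricalComp
    infer_instance
  -- The cells added at both ends are invertible. They supply the `β`'s and the `ω₃` from which W7
  -- and W5, read backwards, rebuild the loop.
  rw [← cancel_epi (𝟙 ((ttpη ≫ ttm) ≫ tl ≫ l₁ ≫ pm) ⊗≫ ttb.inv ▷ (tl ≫ l₁ ≫ pm) ⊗≫
      (tl ≫ l₁ ≫ pm) ◁ bT.hom ⊗≫ 𝟙 ((tl ≫ l₁) ≫ (pm ≫ pηT) ≫ μT)),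
    ← cancel_mono (𝟙 ((tl ≫ l₁) ≫ (pm ≫ pηT) ≫ μT) ⊗≫ o₃.hom ▷ (pηT ≫ μT))]
  symm
  calc
    _ = 𝟙 _ ⊗≫ ttb.inv ▷ (tl ≫ l₁ ≫ pm) ⊗≫ ((tl ≫ l₁ ≫ pm) ◁ bT.hom ≫ o₃.hom ▷ (pηT ≫ μT)) ⊗≫
        𝟙 _ := by bicategory
    _ = 𝟙 _ ⊗≫ (ttb.inv ▷ (tl ≫ l₁ ≫ pm) ≫ 𝟙 s ◁ o₃.hom) ⊗≫ (mP ≫ l) ◁ bT.hom ⊗≫ 𝟙 _ := by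
      rw [whisker_exchange]; bicategory
    -- The inserted pair splits between naturality of `m` at `β^P` (`hM`) and W7 at `X` (`h₇`).
    _ = 𝟙 _ ⊗≫ (ttpη ≫ ttm) ◁ o₃.hom ⊗≫ ttb.inv ▷ (mP ≫ l) ⊗≫
        mP ◁ (tbη.hom ≫ tbη.inv) ▷ l ⊗≫ (mP ≫ l) ◁ bT.hom ⊗≫ 𝟙 _ := by
      rw [← whisker_exchange, Iso.hom_inv_id]; bicategory
    _ = 𝟙 _ ⊗≫ (ttpη ≫ ttm) ◁ o₃.hom ⊗≫
        (𝟙 (ttpη ≫ ttm ≫ mP) ⊗≫ ttb.inv ▷ mP ⊗≫ mP ◁ tbη.hom ⊗≫ 𝟙 ((mP ≫ tpη) ≫ tm)) ▷ l ⊗≫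
        mP ◁ (𝟙 (tpη ≫ tm ≫ l) ⊗≫ tbη.inv ▷ l ⊗≫ l ◁ bT.hom ⊗≫ 𝟙 (l ≫ pηT ≫ μT)) ⊗≫
        𝟙 _ := by bicategory
    _ = 𝟙 _ ⊗≫ (ttpη ≫ ttm) ◁ o₃.hom ⊗≫ ttpη ◁ mn.hom ▷ l ⊗≫
        (mnη.hom ▷ (tm ≫ l) ≫ (mP ≫ tpη) ◁ o₄.hom) ⊗≫
        mP ◁ nη.hom ▷ (pl ≫ μT) ⊗≫ mP ◁ l ◁ po₂.hom ▷ μT ⊗≫ 𝟙 _ := by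
      rw [← hM, ← h₇]; bicategory
    _ = 𝟙 _ ⊗≫ ttpη ◁ (𝟙 (ttm ≫ tl ≫ l₁ ≫ pm) ⊗≫ ttm ◁ o₃.hom ⊗≫ mn.hom ▷ l ⊗≫
          mPP ◁ o₄.hom ⊗≫ 𝟙 (mPP ≫ lP ≫ pl ≫ μT)) ⊗≫ mnη.hom ▷ (lP ≫ pl ≫ μT) ⊗≫
        mP ◁ nη.hom ▷ (pl ≫ μT) ⊗≫ mP ◁ l ◁ po₂.hom ▷ μT ⊗≫ 𝟙 _ := by
      rw [← whisker_exchange]; bicategory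
    _ = 𝟙 _ ⊗≫ ttpη ◁ to₄.hom ▷ (l₁ ≫ pm) ⊗≫ ttpη ◁ (tlP ≫ tpl) ◁ o₄T.hom ▷ pm ⊗≫
        ttpη ◁ tlP ◁ ln.hom ▷ (pl₁ ≫ mTT ≫ pm) ⊗≫
        ttpη ◁ (tlP ≫ lTP ≫ ptl ≫ pl₁) ◁ nm.inv ⊗≫ ttpη ◁ (tlP ≫ lTP) ◁ po₃.hom ▷ μT ⊗≫
        (ttpη ◁ o₃P.hom ⊗≫ mnη.hom ▷ lP ⊗≫ mP ◁ nη.hom) ▷ (pl ≫ μT) ⊗≫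
        mP ◁ l ◁ po₂.hom ▷ μT ⊗≫ 𝟙 _ := by
      rw [← h₅]; bicategory
    _ = 𝟙 _ ⊗≫ ttpη ◁ to₄.hom ▷ (l₁ ≫ pm) ⊗≫
        ((ttpη ≫ tlP) ◁ (tpl ◁ o₄T.hom ▷ pm ⊗≫ ln.hom ▷ (pl₁ ≫ mTT ≫ pm) ⊗≫
            (lTP ≫ ptl ≫ pl₁) ◁ nm.inv ⊗≫ lTP ◁ po₃.hom ▷ μT ⊗≫
            𝟙 ((lTP ≫ pmP) ≫ pl ≫ μT)) ≫
          tnη.hom ▷ ((lTP ≫ pmP) ≫ pl ≫ μT)) ⊗≫ tl ◁ nTη.hom ▷ (pmP ≫ pl ≫ μT) ⊗≫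
        (tl ≫ l₁) ◁ pmn.hom ▷ (pl ≫ μT) ⊗≫
        (o₃.hom ▷ (ptη ≫ pl ≫ μT) ≫ (mP ≫ l) ◁ (𝟙 (ptη ≫ pl ≫ μT) ⊗≫ po₂.hom ▷ μT)) ⊗≫
        𝟙 _ := by
      rw [h₃]; bicategory
    _ = 𝟙 _ ⊗≫ ttpη ◁ to₄.hom ▷ (l₁ ≫ pm) ⊗≫ tnη.hom ▷ (tpl ≫ tmT ≫ l₁ ≫ pm) ⊗≫
        tl ◁ (tpo₂.hom ≫ tpo₂.inv) ▷ (tmT ≫ l₁ ≫ pm) ⊗≫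
        (tl ≫ tptη ≫ tpl) ◁ o₄T.hom ▷ pm ⊗≫ (tl ≫ tptη) ◁ ln.hom ▷ (pl₁ ≫ mTT ≫ pm) ⊗≫
        tl ◁ ((tptη ≫ lTP) ◁ ((ptl ≫ pl₁) ◁ nm.inv ⊗≫ po₃.hom ▷ μT ⊗≫
            𝟙 (pmP ≫ pl ≫ μT)) ≫ nTη.hom ▷ (pmP ≫ pl ≫ μT)) ⊗≫
        (tl ≫ l₁) ◁ pmn.hom ▷ (pl ≫ μT) ⊗≫ (tl ≫ l₁ ≫ pm) ◁ po₂.hom ▷ μT ⊗≫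
        o₃.hom ▷ (pηT ≫ μT) ⊗≫ 𝟙 _ := by
      rw [whisker_exchange tnη.hom, ← whisker_exchange o₃.hom, Iso.hom_inv_id]; bicategory
    _ = 𝟙 _ ⊗≫ (ttpη ◁ to₄.hom ⊗≫ tnη.hom ▷ (tpl ≫ tmT) ⊗≫ tl ◁ tpo₂.hom ▷ tmT) ▷ (l₁ ≫ pm) ⊗≫
        tl ◁ (tpo₂.inv ▷ (tmT ≫ l₁ ≫ pm) ≫
          (tptη ≫ tpl) ◁ (𝟙 (tmT ≫ l₁ ≫ pm) ⊗≫ o₄T.hom ▷ pm)) ⊗≫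
        tl ◁ (tptη ◁ ln.hom ⊗≫ nTη.hom ▷ ptl ⊗≫ l₁ ◁ (pto₂.hom ≫ pto₂.inv)) ▷
          (pl₁ ≫ mTT ≫ pm) ⊗≫
        (tl ≫ l₁ ≫ pttη ≫ ptl ≫ pl₁) ◁ nm.inv ⊗≫ (tl ≫ l₁ ≫ pttη) ◁ po₃.hom ▷ μT ⊗≫
        (tl ≫ l₁) ◁ pmn.hom ▷ (pl ≫ μT) ⊗≫ (tl ≫ l₁ ≫ pm) ◁ po₂.hom ▷ μT ⊗≫
        o₃.hom ▷ (pηT ≫ μT) ⊗≫ 𝟙 _ := by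
      rw [whisker_exchange nTη.hom, Iso.hom_inv_id pto₂]; bicategory
    _ = 𝟙 _ ⊗≫ (𝟙 (ttpη ≫ ttm ≫ tl) ⊗≫ ttb.inv ▷ tl ⊗≫ tl ◁ tbT.hom ⊗≫
          𝟙 (tl ≫ tpηT ≫ tmT)) ▷ (l₁ ≫ pm) ⊗≫
        tl ◁ tpηT ◁ o₄T.hom ▷ pm ⊗≫ tl ◁ tpo₂.inv ▷ (lPT ≫ pl₁ ≫ mTT ≫ pm) ⊗≫
        tl ◁ (𝟙 ((tptη ≫ tpl) ≫ lPT) ⊗≫ tptη ◁ ln.hom ⊗≫ nTη.hom ▷ ptl ⊗≫ l₁ ◁ pto₂.hom ⊗≫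
          𝟙 (l₁ ≫ ptηT)) ▷ (pl₁ ≫ mTT ≫ pm) ⊗≫
        (tl ≫ l₁) ◁ pto₂.inv ▷ (pl₁ ≫ mTT ≫ pm) ⊗≫
        (tl ≫ l₁ ≫ pttη ≫ ptl ≫ pl₁) ◁ nm.inv ⊗≫ (tl ≫ l₁ ≫ pttη) ◁ po₃.hom ▷ μT ⊗≫
        (tl ≫ l₁) ◁ pmn.hom ▷ (pl ≫ μT) ⊗≫ (tl ≫ l₁ ≫ pm) ◁ po₂.hom ▷ μT ⊗≫
        o₃.hom ▷ (pηT ≫ μT) ⊗≫ 𝟙 _ := by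
      rw [th₇, ← whisker_exchange tpo₂.inv]; bicategory
    _ = 𝟙 _ ⊗≫ ttb.inv ▷ (tl ≫ l₁ ≫ pm) ⊗≫ tl ◁ tbT.hom ▷ (l₁ ≫ pm) ⊗≫
        tl ◁ tpηT ◁ o₄T.hom ▷ pm ⊗≫ tl ◁ (tpo₂.inv ≫ tpo₂.hom) ▷ (lPT ≫ pl₁ ≫ mTT ≫ pm) ⊗≫
        tl ◁ nηT.hom ▷ (pl₁ ≫ mTT ≫ pm) ⊗≫
        (tl ≫ l₁) ◁ (po₂T.hom ≫ po₂T.inv) ▷ (mTT ≫ pm) ⊗≫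
        (tl ≫ l₁) ◁ (pto₂.inv ▷ (pl₁ ≫ mTT ≫ pm) ≫
          (pttη ≫ ptl) ◁ (𝟙 (pl₁ ≫ mTT ≫ pm) ⊗≫ pl₁ ◁ nm.inv)) ⊗≫
        (tl ≫ l₁ ≫ pttη) ◁ po₃.hom ▷ μT ⊗≫
        (tl ≫ l₁) ◁ pmn.hom ▷ (pl ≫ μT) ⊗≫ (tl ≫ l₁ ≫ pm) ◁ po₂.hom ▷ μT ⊗≫
        o₃.hom ▷ (pηT ≫ μT) ⊗≫ 𝟙 _ := by
      rw [← hN, Iso.hom_inv_id]; bicategory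
    _ = 𝟙 _ ⊗≫ ttb.inv ▷ (tl ≫ l₁ ≫ pm) ⊗≫ tl ◁ tbT.hom ▷ (l₁ ≫ pm) ⊗≫
        tl ◁ (tpηT ◁ o₄T.hom ⊗≫ nηT.hom ▷ (pl₁ ≫ mTT) ⊗≫ l₁ ◁ po₂T.hom ▷ mTT) ▷ pm ⊗≫
        (tl ≫ l₁) ◁ (po₂T.inv ▷ (mTT ≫ pm) ≫ (ptηT ≫ pl₁) ◁ nm.inv) ⊗≫
        (tl ≫ l₁) ◁ pto₂.inv ▷ (pl₁ ≫ ppm ≫ μT) ⊗≫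
        (tl ≫ l₁ ≫ pttη) ◁ po₃.hom ▷ μT ⊗≫
        (tl ≫ l₁) ◁ pmn.hom ▷ (pl ≫ μT) ⊗≫ (tl ≫ l₁ ≫ pm) ◁ po₂.hom ▷ μT ⊗≫
        o₃.hom ▷ (pηT ≫ μT) ⊗≫ 𝟙 _ := by
      rw [← whisker_exchange pto₂.inv, Iso.inv_hom_id]; bicategory
    _ = 𝟙 _ ⊗≫ ttb.inv ▷ (tl ≫ l₁ ≫ pm) ⊗≫ tl ◁ (tbT.hom ≫ tbT.inv) ▷ (l₁ ≫ pm) ⊗≫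
        (tl ≫ l₁) ◁ (𝟙 (𝟙 c ≫ pm) ⊗≫ bTT.hom ▷ pm ⊗≫ 𝟙 (pηTT ≫ mTT ≫ pm)) ⊗≫
        (tl ≫ l₁) ◁ pηTT ◁ nm.inv ⊗≫ (tl ≫ l₁) ◁ po₂T.inv ▷ (ppm ≫ μT) ⊗≫
        (tl ≫ l₁) ◁ pto₂.inv ▷ (pl₁ ≫ ppm ≫ μT) ⊗≫
        (tl ≫ l₁ ≫ pttη) ◁ po₃.hom ▷ μT ⊗≫
        (tl ≫ l₁) ◁ pmn.hom ▷ (pl ≫ μT) ⊗≫ (tl ≫ l₁ ≫ pm) ◁ po₂.hom ▷ μT ⊗≫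
        o₃.hom ▷ (pηT ≫ μT) ⊗≫ 𝟙 _ := by
      rw [← whisker_exchange po₂T.inv, h₇T]; bicategory
    -- W7 at `TX` and its `T`-image leave only `β^P` at `T²X`, which is moved along `m` to `TX` by
    -- its modification property.
    _ = 𝟙 _ ⊗≫ ttb.inv ▷ (tl ≫ l₁ ≫ pm) ⊗≫
        (tl ≫ l₁) ◁ (pm ◁ bT.hom ⊗≫ pnm.hom ▷ μT ⊗≫ pηTT ◁ nm.hom) ⊗≫
        (tl ≫ l₁) ◁ pηTT ◁ nm.inv ⊗≫ (tl ≫ l₁) ◁ po₂T.inv ▷ (ppm ≫ μT) ⊗≫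
        (tl ≫ l₁) ◁ pto₂.inv ▷ (pl₁ ≫ ppm ≫ μT) ⊗≫
        (tl ≫ l₁ ≫ pttη) ◁ po₃.hom ▷ μT ⊗≫
        (tl ≫ l₁) ◁ pmn.hom ▷ (pl ≫ μT) ⊗≫ (tl ≫ l₁ ≫ pm) ◁ po₂.hom ▷ μT ⊗≫
        o₃.hom ▷ (pηT ≫ μT) ⊗≫ 𝟙 _ := by
      rw [hb, Iso.hom_inv_id]; bicategory
    _ = 𝟙 _ ⊗≫ ttb.inv ▷ (tl ≫ l₁ ≫ pm) ⊗≫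
        (tl ≫ l₁) ◁ pm ◁ bT.hom ⊗≫ (tl ≫ l₁) ◁ pnm.hom ▷ μT ⊗≫
        (tl ≫ l₁ ≫ pηTT) ◁ (nm.hom ≫ nm.inv) ⊗≫ (tl ≫ l₁) ◁ po₂T.inv ▷ (ppm ≫ μT) ⊗≫
        (tl ≫ l₁) ◁ pto₂.inv ▷ (pl₁ ≫ ppm ≫ μT) ⊗≫
        (tl ≫ l₁ ≫ pttη) ◁ po₃.hom ▷ μT ⊗≫
        (tl ≫ l₁) ◁ pmn.hom ▷ (pl ≫ μT) ⊗≫ (tl ≫ l₁ ≫ pm) ◁ po₂.hom ▷ μT ⊗≫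
        o₃.hom ▷ (pηT ≫ μT) ⊗≫ 𝟙 _ := by bicategory
    _ = _ := by
      rw [Iso.hom_inv_id]; bicategory

end Pasting

section MulCounit

variable {C : Type u} [Bicategory.{w, v} C]

lemma right_unit_pasting_of_eq_id {a s k r n : C} {l : a ⟶ k} {tη : a ⟶ s} {tm : s ⟶ a}
    {lP : s ⟶ r} {ptη : k ⟶ r} {pl : r ⟶ n} {μT : n ⟶ k} {pηT : k ⟶ n}
    (tb : 𝟙 a ≅ tη ≫ tm) (o₄ : tm ≫ l ≅ lP ≫ pl ≫ μT) (nη : tη ≫ lP ≅ l ≫ ptη)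
    (po₂ : ptη ≫ pl ≅ pηT) (bT : 𝟙 k ≅ pηT ≫ μT)
    (h : (𝟙 l ⊗≫ tb.hom ▷ l ⊗≫ tη ◁ o₄.hom ⊗≫ nη.hom ▷ (pl ≫ μT) ⊗≫ l ◁ po₂.hom ▷ μT ⊗≫
      l ◁ bT.inv ⊗≫ 𝟙 l) = 𝟙 l) :
    tη ◁ o₄.hom ⊗≫ nη.hom ▷ (pl ≫ μT) ⊗≫ l ◁ po₂.hom ▷ μT =
      𝟙 _ ⊗≫ tb.inv ▷ l ⊗≫ l ◁ bT.hom ⊗≫ 𝟙 _ := by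
  calc
    _ = 𝟙 _ ⊗≫ (tb.inv ≫ tb.hom) ▷ l ⊗≫ tη ◁ o₄.hom ⊗≫ nη.hom ▷ (pl ≫ μT) ⊗≫
        l ◁ po₂.hom ▷ μT ⊗≫ l ◁ (bT.inv ≫ bT.hom) ⊗≫ 𝟙 _ := by
      rw [Iso.inv_hom_id, Iso.inv_hom_id]; bicategory
    _ = 𝟙 _ ⊗≫ tb.inv ▷ l ⊗≫ (𝟙 l ⊗≫ tb.hom ▷ l ⊗≫ tη ◁ o₄.hom ⊗≫ nη.hom ▷ (pl ≫ μT) ⊗≫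
        l ◁ po₂.hom ▷ μT ⊗≫ l ◁ bT.inv ⊗≫ 𝟙 l) ⊗≫ l ◁ bT.hom ⊗≫ 𝟙 _ := by
      bicategory
    _ = _ := by
      rw [h]; bicategory

/-- Since `j ≫ k` is isomorphic to `η`, the hypothesis also gives equality after whiskering with `η`
on the left. Naturality of `η` moves `η` to the other side of `E`, and `α^P` cancels it against `μ`.
-/
lemma Pseudomonad.eq_of_whiskerLeft_cell_eq (P : Pseudomonad C) {W Y Z : C}
    {f g : Y ⟶ P.F.obj Z} {E E' : f ⟶ g} {p q} [MapIso P.F f p] [MapIso P.F g q] {j : Y ⟶ W}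
    {k : W ⟶ P.F.obj Y} (i : j ≫ k ≅ P.u Y)
    (h : k ◁ (P.F.cell E ▷ P.m Z) = k ◁ (P.F.cell E' ▷ P.m Z)) : E = E' := by
  have h₁ : E ▷ (P.u _ ≫ P.m Z) = E' ▷ (P.u _ ≫ P.m Z) := by
    have e : ∀ E : f ⟶ g, E ▷ (P.u _ ≫ P.m Z) =
        𝟙 _ ⊗≫ (P.uCell f).hom ▷ P.m Z ⊗≫ i.inv ▷ (p ≫ P.m Z) ⊗≫
          j ◁ (k ◁ (P.F.cell E ▷ P.m Z)) ⊗≫ i.hom ▷ (q ≫ P.m Z) ⊗≫ (P.uCell g).inv ▷ P.m Z ⊗≫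
          𝟙 _ := by
      intro E
      calc
        _ = 𝟙 _ ⊗≫ (E ▷ P.u _ ≫ (P.uCell g).hom ≫ (P.uCell g).inv) ▷ P.m Z ⊗≫ 𝟙 _ := by
          rw [Iso.hom_inv_id]; bicategory
        _ = 𝟙 _ ⊗≫ (P.uCell f).hom ▷ P.m Z ⊗≫
            (P.u Y ◁ (P.F.cell E ▷ P.m Z) ≫ (i.inv ≫ i.hom) ▷ (q ≫ P.m Z)) ⊗≫
            (P.uCell g).inv ▷ P.m Z ⊗≫ 𝟙 _ := by
          rw [← Category.assoc (E ▷ _), P.uCell_naturality, Iso.inv_hom_id]; bicategory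
        _ = 𝟙 _ ⊗≫ (P.uCell f).hom ▷ P.m Z ⊗≫
            (P.u Y ◁ (P.F.cell E ▷ P.m Z) ≫ i.inv ▷ (q ≫ P.m Z)) ⊗≫ i.hom ▷ (q ≫ P.m Z) ⊗≫
            (P.uCell g).inv ▷ P.m Z ⊗≫ 𝟙 _ := by bicategory
        _ = _ := by
          rw [whisker_exchange]; bicategory
    rw [e, e, h]
  have e : ∀ E : f ⟶ g, E = (ρ_ f).inv ≫ f ◁ (P.α Z).inv ≫
      E ▷ (P.u _ ≫ P.m Z) ≫ g ◁ (P.α Z).hom ≫ (ρ_ g).hom := by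
    intro E
    rw [← whisker_exchange_assoc]
    simp
  rw [e E, e E', h₁]

/-- Rewrites W8 as the triviality of one loop on `ηT ∘ m`, the form the test on the `P` side can be
applied to. -/
lemma pasting_eq_of_eq_id {a b c d k e i : C} {ttη : a ⟶ b} {tl : b ⟶ c} {l₁ : c ⟶ d}
    {pm : d ⟶ e} {tm : b ⟶ k} {l : k ⟶ e} {m : a ⟶ i} {tη : i ⟶ k} {ηT : i ⟶ e}
    {tηT : a ⟶ c} {ηTT : a ⟶ d} (o₃ : tl ≫ l₁ ≫ pm ≅ tm ≫ l) (mn : ttη ≫ tm ≅ m ≫ tη)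
    (o₂ : tη ≫ l ≅ ηT) (to₂ : ttη ≫ tl ≅ tηT) (o₂T : tηT ≫ l₁ ≅ ηTT) (nm : m ≫ ηT ≅ ηTT ≫ pm)
    (h : (𝟙 (m ≫ ηT) ⊗≫ nm.hom ⊗≫ o₂T.inv ▷ pm ⊗≫ to₂.inv ▷ (l₁ ≫ pm) ⊗≫ ttη ◁ o₃.hom ⊗≫
      mn.hom ▷ l ⊗≫ m ◁ o₂.hom ⊗≫ 𝟙 (m ≫ ηT)) = 𝟙 _) :
    (𝟙 (ttη ≫ tl ≫ l₁ ≫ pm) ⊗≫ ttη ◁ o₃.hom ⊗≫ mn.hom ▷ l ⊗≫ m ◁ o₂.hom ⊗≫ 𝟙 (m ≫ ηT)) =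
      𝟙 _ ⊗≫ to₂.hom ▷ (l₁ ≫ pm) ⊗≫ o₂T.hom ▷ pm ⊗≫ nm.inv ⊗≫ 𝟙 _ := by
  symm
  calc
    _ = 𝟙 _ ⊗≫ to₂.hom ▷ (l₁ ≫ pm) ⊗≫ o₂T.hom ▷ pm ⊗≫ nm.inv ⊗≫ 𝟙 (m ≫ ηT) ⊗≫ 𝟙 _ := by
      bicategory
    _ = 𝟙 _ ⊗≫ to₂.hom ▷ (l₁ ≫ pm) ⊗≫ o₂T.hom ▷ pm ⊗≫ (nm.inv ≫ nm.hom) ⊗≫ o₂T.inv ▷ pm ⊗≫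
        to₂.inv ▷ (l₁ ≫ pm) ⊗≫ ttη ◁ o₃.hom ⊗≫ mn.hom ▷ l ⊗≫ m ◁ o₂.hom ⊗≫ 𝟙 _ := by
      rw [← h]; bicategory
    _ = 𝟙 _ ⊗≫ to₂.hom ▷ (l₁ ≫ pm) ⊗≫ (o₂T.hom ≫ o₂T.inv) ▷ pm ⊗≫
        to₂.inv ▷ (l₁ ≫ pm) ⊗≫ ttη ◁ o₃.hom ⊗≫ mn.hom ▷ l ⊗≫ m ◁ o₂.hom ⊗≫ 𝟙 _ := by
      rw [Iso.inv_hom_id]; bicategory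
    _ = 𝟙 _ ⊗≫ (to₂.hom ≫ to₂.inv) ▷ (l₁ ≫ pm) ⊗≫ ttη ◁ o₃.hom ⊗≫ mn.hom ▷ l ⊗≫
        m ◁ o₂.hom ⊗≫ 𝟙 _ := by
      rw [Iso.hom_inv_id]; bicategory
    _ = _ := by
      rw [Iso.hom_inv_id]; bicategory

namespace PseudodistributiveLaw

variable {T P : Pseudomonad C} (D : PseudodistributiveLaw T P)

/-- The modification axiom of `ω₃` as an equation of pastings. -/
lemma ω₃_square {X Y : C} (f : X ⟶ Y) :
    T.F.map (T.F.map (P.F.map f)) ◁ (D.ω₃ Y).hom ⊗≫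
        (T.mNat (P.F.map f)).hom ▷ D.lam Y ⊗≫ T.m (P.F.obj X) ◁ (D.lamNat f).hom =
      𝟙 _ ⊗≫ T.F.cell (D.lamNat f).hom ▷ (D.lam (T.F.obj Y) ≫ P.F.map (T.m Y)) ⊗≫
        T.F.map (D.lam X) ◁ (D.lamNat (T.F.map f)).hom ▷ P.F.map (T.m Y) ⊗≫
        (T.F.map (D.lam X) ≫ D.lam (T.F.obj X)) ◁ P.F.cell (T.mNat f).hom ⊗≫
        (D.ω₃ X).hom ▷ P.F.map (T.F.map f) ⊗≫ 𝟙 _ := by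
  have h := D.ω₃_modification f
  simp only [pasteSquare, Iso.trans_hom, Iso.symm_hom, whiskerLeftIso_hom,
    whiskerRightIso_hom, Pseudofunctor.mapSquare_hom, Category.assoc] at h
  exact eq_of_coherence h (by bicategory) (by bicategory)

/-- A solved form of `W7`. -/
lemma w7_solved (X : C) :
    T.F.map (P.F.map (P.u X)) ◁ (D.ω₄ X).hom ⊗≫
        (D.lamNat (P.u X)).hom ▷ (P.F.map (D.lam X) ≫ P.m (T.F.obj X)) ⊗≫
        D.lam X ◁ P.F.cell (D.ω₂ X).hom ▷ P.m (T.F.obj X) =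
      𝟙 _ ⊗≫ T.F.cell (P.β X).inv ▷ D.lam X ⊗≫ D.lam X ◁ (P.β (T.F.obj X)).hom ⊗≫ 𝟙 _ := by
  have h := D.w7 X
  rw [Pseudofunctor.mapCell_id_comp, Pseudofunctor.mapCell_comp_refl] at h
  exact right_unit_pasting_of_eq_id (T.F.cellIso (P.β X)) (D.ω₄ X) (D.lamNat (P.u X))
    (P.F.cellIso (D.ω₂ X)) (P.β (T.F.obj X)) h

theorem w8 : D.W8 := by
  intro X
  rw [Pseudofunctor.mapCell_comp_refl]
  refine pasting_eq_of_eq_id (D.ω₃ X) (T.mNat (P.u X)) (D.ω₂ X) (T.F.cellIso (D.ω₂ X))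
    (D.ω₂ (T.F.obj X)) (P.uNat (T.m X)) ?_
  -- By `Tω₂` and `ω₂T`, the 1-cell `T²η` followed by `Tλ` and `λT` is isomorphic to `η` at `T²X`.
  refine P.eq_of_whiskerLeft_cell_eq (j := T.F.map (T.F.map (P.u X)))
    (k := T.F.map (D.lam X) ≫ D.lam (T.F.obj X))
    ((α_ _ _ _).symm ≪≫ whiskerRightIso (T.F.cellIso (D.ω₂ X)) _ ≪≫ D.ω₂ (T.F.obj X)) ?_
  have key := mul_counit_pasting_eq (T.F.cellIso (D.ω₄ X)) (D.ω₄ (T.F.obj X))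
    (D.lamNat (D.lam X)) (P.mNat (T.m X)) (P.F.cellIso (D.ω₃ X)) (D.ω₃ (P.F.obj X)) (D.ω₃ X)
    (T.mNat (P.m X)) (D.ω₄ X) (T.F.cellIso (P.β X)) (T.F.cellIso (T.F.cellIso (P.β X)))
    (P.β (T.F.obj X)) (P.β (T.F.obj (T.F.obj X))) (T.F.cellIso (P.β (T.F.obj X)))
    (P.F.cellIso (D.ω₂ X)) (P.F.cellIso (D.ω₂ (T.F.obj X)))
    (T.F.cellIso (P.F.cellIso (D.ω₂ X))) (P.F.cellIso (T.F.cellIso (D.ω₂ X)))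
    (D.lamNat (P.u X)) (D.lamNat (P.u (T.F.obj X))) (D.lamNat (T.F.map (P.u X)))
    (T.F.cellIso (D.lamNat (P.u X))) (T.mNat (P.F.map (P.u X))) (P.F.cellIso (T.mNat (P.u X)))
    (P.F.cellIso (P.uNat (T.m X))) ?_ (D.w7_solved X) (D.w7_solved (T.F.obj X)) ?_ ?_
    (D.ω₃_square (P.u X)) ?_ (P.β_square (T.m X))
  · refine Eq.trans ?_ (key.trans ?_)
    · congr 2
      simp [bicategoricalComp]
    · simp
  · have := D.w5 X
    simpa only [Pseudofunctor.mapCell_compThree_comp, Pseudofunctor.mapCell_comp_comp,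
      Pseudofunctor.mapCell_comp_compThree, Pseudofunctor.cellIso_hom] using this
  · have := T.F.cell_congr (D.w7_solved X)
    simp [bicategoricalComp] at this
    simp [bicategoricalComp, this]
  · have := D.lamCell_naturality (D.ω₂ X).hom
    simp only [D.lamCell_comp, D.lamCell_atom, pasteAlong_hom] at this
    exact eq_of_coherence this (by bicategory) (by bicategory)
  · have := (Iso.eq_inv_comp (whiskerRightIso (T.F.cellIso (T.F.cellIso (P.β X)))
      (T.m (P.F.obj X)))).2 (T.mCell_naturality (P.β X).hom)
    simp only [T.mCell_comp, T.mCell_atom, T.mCell_id, pasteAlong_hom, idSquare,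
      Iso.symm_hom, Iso.trans_inv, Iso.symm_inv, whiskerRightIso_inv] at this
    exact eq_of_coherence this (by bicategory) (by bicategory)

end PseudodistributiveLaw

end MulCounit

/-! ### W10, from W1 and W8. -/

section Pasting

variable {C : Type u} [Bicategory.{w, v} C]

/-- The two sides of `W10` agree after whiskering by `T`. -/
lemma unit_unit_pasting_eq {a b c d e k e₂ : C} {tη : a ⟶ k} {tpu : k ⟶ b} {l : k ⟶ d}
    {l₁ : b ⟶ c} {pm : c ⟶ d} {ptu : d ⟶ c} {tuP : k ⟶ e} {tl : e ⟶ b} {mP : e ⟶ k}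
    {tu : a ⟶ e₂} {ttη : e₂ ⟶ e} {m : e₂ ⟶ a} {ηT : a ⟶ d} {tηT : e₂ ⟶ b} {ηTT : e₂ ⟶ c}
    (w₁ : tpu ≅ tuP ≫ tl) (o₃ : tl ≫ l₁ ≫ pm ≅ mP ≫ l) (nu : tpu ≫ l₁ ≅ l ≫ ptu)
    (pb : 𝟙 d ≅ ptu ≫ pm) (bP : 𝟙 k ≅ tuP ≫ mP) (b' : 𝟙 a ≅ tu ≫ m)
    (un : tη ≫ tuP ≅ tu ≫ ttη) (mn : ttη ≫ mP ≅ m ≫ tη) (o₂ : tη ≫ l ≅ ηT)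
    (to₂ : ttη ≫ tl ≅ tηT) (o₂T : tηT ≫ l₁ ≅ ηTT) (nm : m ≫ ηT ≅ ηTT ≫ pm)
    (nTu : tu ≫ ηTT ≅ ηT ≫ ptu) (tnu : tu ≫ tηT ≅ tη ≫ tpu)
    (h₁ : w₁.hom ▷ (l₁ ≫ pm) ⊗≫ tuP ◁ o₃.hom =
      𝟙 _ ⊗≫ nu.hom ▷ pm ⊗≫ l ◁ pb.inv ⊗≫ bP.hom ▷ l ⊗≫ 𝟙 _)
    (hb : tη ◁ bP.hom ⊗≫ un.hom ▷ mP ⊗≫ tu ◁ mn.hom = 𝟙 _ ⊗≫ b'.hom ▷ tη ⊗≫ 𝟙 _)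
    (h₈ : (𝟙 (ttη ≫ tl ≫ l₁ ≫ pm) ⊗≫ ttη ◁ o₃.hom ⊗≫ mn.hom ▷ l ⊗≫ m ◁ o₂.hom ⊗≫
        𝟙 (m ≫ ηT)) =
      𝟙 _ ⊗≫ to₂.hom ▷ (l₁ ≫ pm) ⊗≫ o₂T.hom ▷ pm ⊗≫ nm.inv ⊗≫ 𝟙 _)
    (h₂ : tu ◁ o₂T.hom ⊗≫ nTu.hom =
      𝟙 _ ⊗≫ tnu.hom ▷ l₁ ⊗≫ tη ◁ nu.hom ⊗≫ o₂.hom ▷ ptu ⊗≫ 𝟙 _)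
    (hB : nTu.inv ▷ pm ⊗≫ tu ◁ nm.inv = 𝟙 _ ⊗≫ ηT ◁ pb.inv ⊗≫ b'.hom ▷ ηT ⊗≫ 𝟙 _) :
    (𝟙 (tη ≫ tpu) ⊗≫ tη ◁ w₁.hom ⊗≫ un.hom ▷ tl ⊗≫ tu ◁ to₂.hom ⊗≫ 𝟙 (tu ≫ tηT)) ▷
        (l₁ ≫ pm) ⊗≫ tu ◁ (o₂T.hom ▷ pm ⊗≫ nm.inv) =
      tnu.inv ▷ (l₁ ≫ pm) ⊗≫ tu ◁ (o₂T.hom ▷ pm ⊗≫ nm.inv) := by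
  calc
    _ = 𝟙 _ ⊗≫ tη ◁ w₁.hom ▷ (l₁ ≫ pm) ⊗≫ un.hom ▷ (tl ≫ l₁ ≫ pm) ⊗≫
        tu ◁ (𝟙 (ttη ≫ tl ≫ l₁ ≫ pm) ⊗≫ to₂.hom ▷ (l₁ ≫ pm) ⊗≫ o₂T.hom ▷ pm ⊗≫ nm.inv ⊗≫
          𝟙 (m ≫ ηT)) ⊗≫ 𝟙 _ := by bicategory
    -- W8 read backwards brings in `ω₃`, so that W1 can absorb it together with `Tω₁`.
    _ = 𝟙 _ ⊗≫ tη ◁ w₁.hom ▷ (l₁ ≫ pm) ⊗≫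
        (un.hom ▷ (tl ≫ l₁ ≫ pm) ≫ (tu ≫ ttη) ◁ o₃.hom) ⊗≫
        tu ◁ mn.hom ▷ l ⊗≫ tu ◁ m ◁ o₂.hom ⊗≫ 𝟙 _ := by
      rw [← h₈]; bicategory
    _ = 𝟙 _ ⊗≫ tη ◁ (w₁.hom ▷ (l₁ ≫ pm) ⊗≫ tuP ◁ o₃.hom) ⊗≫ un.hom ▷ (mP ≫ l) ⊗≫
        tu ◁ mn.hom ▷ l ⊗≫ tu ◁ m ◁ o₂.hom ⊗≫ 𝟙 _ := by
      rw [← whisker_exchange]; bicategory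
    _ = 𝟙 _ ⊗≫ tη ◁ nu.hom ▷ pm ⊗≫ tη ◁ l ◁ pb.inv ⊗≫
        (tη ◁ bP.hom ⊗≫ un.hom ▷ mP ⊗≫ tu ◁ mn.hom) ▷ l ⊗≫ tu ◁ m ◁ o₂.hom ⊗≫ 𝟙 _ := by
      rw [h₁]; bicategory
    _ = 𝟙 _ ⊗≫ tη ◁ nu.hom ▷ pm ⊗≫ (tη ≫ l) ◁ pb.inv ⊗≫
        (b'.hom ▷ (tη ≫ l) ≫ (tu ≫ m) ◁ o₂.hom) ⊗≫ 𝟙 _ := by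
      rw [hb]; bicategory
    _ = 𝟙 _ ⊗≫ tη ◁ nu.hom ▷ pm ⊗≫ ((tη ≫ l) ◁ pb.inv ≫ o₂.hom ▷ 𝟙 d) ⊗≫
        b'.hom ▷ ηT ⊗≫ 𝟙 _ := by
      rw [← whisker_exchange]; bicategory
    _ = 𝟙 _ ⊗≫ tη ◁ nu.hom ▷ pm ⊗≫ o₂.hom ▷ (ptu ≫ pm) ⊗≫
        (𝟙 ((ηT ≫ ptu) ≫ pm) ⊗≫ ηT ◁ pb.inv ⊗≫ b'.hom ▷ ηT ⊗≫ 𝟙 (tu ≫ m ≫ ηT)) ⊗≫ 𝟙 _ := by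
      rw [whisker_exchange]; bicategory
    -- The inserted pair completes one side of the modification axiom of `ω₂` at `u`; its unused
    -- half is the right-hand side of W10 under `T`.
    _ = 𝟙 _ ⊗≫ (tnu.inv ≫ tnu.hom) ▷ (l₁ ≫ pm) ⊗≫ tη ◁ nu.hom ▷ pm ⊗≫
        o₂.hom ▷ (ptu ≫ pm) ⊗≫ nTu.inv ▷ pm ⊗≫ tu ◁ nm.inv ⊗≫ 𝟙 _ := by
      rw [← hB, Iso.inv_hom_id]; bicategory
    _ = 𝟙 _ ⊗≫ tnu.inv ▷ (l₁ ≫ pm) ⊗≫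
        (𝟙 (tu ≫ tηT ≫ l₁) ⊗≫ tnu.hom ▷ l₁ ⊗≫ tη ◁ nu.hom ⊗≫ o₂.hom ▷ ptu ⊗≫
          𝟙 (ηT ≫ ptu)) ▷ pm ⊗≫ nTu.inv ▷ pm ⊗≫ tu ◁ nm.inv ⊗≫ 𝟙 _ := by bicategory
    _ = 𝟙 _ ⊗≫ tnu.inv ▷ (l₁ ≫ pm) ⊗≫ tu ◁ o₂T.hom ▷ pm ⊗≫ (nTu.hom ≫ nTu.inv) ▷ pm ⊗≫
        tu ◁ nm.inv ⊗≫ 𝟙 _ := by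
      rw [← h₂]; bicategory
    _ = _ := by
      rw [Iso.hom_inv_id]; bicategory

end Pasting

section UnitUnit

variable {C : Type u} [Bicategory.{w, v} C] {T P : Pseudomonad C}

theorem PseudodistributiveLaw.w10 (D : PseudodistributiveLaw T P) : D.W10 := by
  intro X
  apply D.eq_of_cell_whiskerRight_eq
  have e := unit_unit_pasting_eq (T.F.cellIso (D.ω₁ X)) (D.ω₃ X) (D.lamNat (T.u X))
    (P.F.cellIso (T.β X)) (T.β (P.F.obj X)) (T.β X) (T.F.cellIso (T.uNat (P.u X)))
    (T.mNat (P.u X)) (D.ω₂ X) (T.F.cellIso (D.ω₂ X)) (D.ω₂ (T.F.obj X)) (P.uNat (T.m X))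
    (P.uNat (T.F.map (T.u X))) (T.F.cellIso (P.uNat (T.u X))) (D.w1_solved X)
    (T.β_square (P.u X)) ?_ (D.ω₂_square (T.u X)) ?_
  · refine Eq.trans ?_ ((cancel_coherence ?_ e).trans ?_)
    · congr 1
      simp [bicategoricalComp]
    · unfold bicategoricalComp
      infer_instance
    · simp
  · have := D.w8 X
    simpa only [Pseudofunctor.mapCell_comp_refl, Pseudofunctor.cellIso_hom] using this
  -- The last compatibility is naturality of `η` at the 2-cell `β`.
  · have := P.uCell_naturality (T.β X).hom
    rw [← Iso.eq_comp_inv, Category.assoc, ← Iso.inv_comp_eq] at this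
    have := (Iso.eq_inv_comp (whiskerLeftIso (P.u (T.F.obj X))
      (P.F.cellIso (T.β X)))).2 this.symm
    simp only [P.uCell_comp, P.uCell_atom, P.uCell_id, pasteAlong_inv, idSquare,
      Iso.symm_inv, Iso.trans_hom, Iso.symm_hom, whiskerLeftIso_inv] at this
    exact eq_of_coherence this (by bicategory) (by bicategory)

end UnitUnit

theorem mainTheorem2 {C : Type u} [Bicategory.{w, v} C] (T P : Pseudomonad C)
    (D : PseudodistributiveLaw T P) :
    D.W6 ∧ D.W7 ∧ D.W8 ∧ D.W9 ∧ D.W10 := ⟨D.w6, D.w7, D.w8, D.w9, D.w10⟩
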